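/- Let $d\ge 1$, let $\ell:[0,\infty]\to[0,\infty]$ and put $c(x,y)=\ell(|x-y|)$ for $x,y\in\mathbb{R}^d$. Assume: (A1) $\ell$ is finite, strictly convex, strictly decreasing and $C^1$ on $(0,\infty)$; (A2) $c$ is $C^1$ off the diagonal of $\mathbb{R}^d\times\mathbb{R}^d$; (A3) $c:\mathbb{R}^d\times\mathbb{R}^d\to[0,\infty]$ is lower semicontinuous; (A4) $c(x,x)=+\infty$ for every $x$. Let $\mu$ be a Borel probability measure on $\mathbb{R}^d$ with a density $\rho:\mathbb{R}^d\to[0,\infty)$ with respect to Lebesgue measure such that $\rho(x)=\lambda(|x|)$ for all $x$ and some function $\lambda$, and $\rho>0$ on $\operatorname{supp}\mu$. Let $r_0=\inf\{|x|:x\in\operatorname{supp}\mu\}$ and $R=\sup\{|x|:x\in\operatorname{supp}\mu\}\in(0,\infty]$. Then there is a function $g:[0,\infty)\to\mathbb{R}$ such that the radial map $$T(x)=g(|x|)\,\frac{x}{|x|}\quad(x\ne 0),\qquad T(0)=0,$$ is the optimal transport map from $\mu$ to $\mu$ for the cost $c$. That is, $T$ is Borel, $T_\#\mu=\mu$, and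 $T$ minimizes $\int c(x,S(x))\,d\mu(x)$ among all Borel maps $S$ with $S_\#\mu=\mu$; every other minimizing map agrees with $T$ $\mu$-almost everywhere; and $(\mathrm{id},T)_\#\mu$ is the unique minimizer of $\int c\,d\gamma$ among all measures $\gamma$ on $\mathbb{R}^d\times\mathbb{R}^d$ with both marginals equal to $\mu$. Moreover $g\le 0$; $g$ is nondecreasing on $(r_0,R)$, with $g(s)<g(t)$ whenever $r_0<s<t<R$ and $\mu(\{s<|x|<t\})>0$; and $$\lim_{r\downarrow r_0}g(r)=-R,\qquad \lim_{r\uparrow R}g(r)=-r_0 .$$ In particular, if $0\in\operatorname{supp}\mu$ and $\operatorname{supp}\mu$ is unbounded (for instance if $\operatorname{supp}\mu=\mathbb{R}^d$), then $g$ is increasing on $(0,\infty)$ with $g(0_+)=-\infty$ and $g(+\infty)=0$. -/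

import Mathlib

open MeasureTheory Set Filter Topology
open scoped ENNReal NNReal

noncomputable section

namespace RadialTransport

/-- The Euclidean space `ℝ^d`. -/
abbrev E (d : ℕ) : Type := EuclideanSpace ℝ (Fin d)

/-- The cost `c(x, y) = ℓ(|x - y|)` with values in `[0, ∞]`. -/
def cost {d : ℕ} (ℓ : ℝ≥0∞ → ℝ≥0∞) (x y : E d) : ℝ≥0∞ := ℓ (edist x y)

/-- The real-valued restriction of `ℓ` to finite arguments. -/
def realProfile (ℓ : ℝ≥0∞ → ℝ≥0∞) (r : ℝ) : ℝ := (ℓ (ENNReal.ofReal r)).toReal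

/-- The conditions (A1)-(A4) on `ℓ : [0, ∞] → [0, ∞]` and on the cost `c(x, y) = ℓ(|x - y|)`
in dimension `d`. -/
structure AdmissibleCost (d : ℕ) (ℓ : ℝ≥0∞ → ℝ≥0∞) : Prop where
  /-- (A1) `ℓ` is finite, -/
  finite : ∀ r : ℝ, 0 < r → ℓ (ENNReal.ofReal r) ≠ ∞
  /-- strictly convex, -/
  strictConvex : StrictConvexOn ℝ (Ioi 0) (realProfile ℓ)
  /-- strictly decreasing -/
  strictAnti : StrictAntiOn (realProfile ℓ) (Ioi 0)
  /-- and `C¹` on `(0, ∞)`. -/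
  contDiff : ContDiffOn ℝ 1 (realProfile ℓ) (Ioi 0)
  /-- (A2) `c` is `C¹` off the diagonal. -/
  cost_contDiff : ContDiffOn ℝ 1 (fun p : E d × E d => (cost ℓ p.1 p.2).toReal)
    {p | p.1 ≠ p.2}
  /-- (A3) `c` is lower semicontinuous. -/
  cost_lsc : LowerSemicontinuous (fun p : E d × E d => cost ℓ p.1 p.2)
  /-- (A4) `c` is infinite on the diagonal. -/
  cost_diag : ∀ x : E d, cost ℓ x x = ∞

/-- `γ ∈ Γ(μ, ν)`: the measure `γ` has marginals `μ` and `ν`. -/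
def IsPlan {d : ℕ} (μ ν : Measure (E d)) (γ : Measure (E d × E d)) : Prop :=
  γ.map Prod.fst = μ ∧ γ.map Prod.snd = ν

/-- The transport cost `C[γ] = ∫ c dγ`. -/
def planCost {d : ℕ} (ℓ : ℝ≥0∞ → ℝ≥0∞) (γ : Measure (E d × E d)) : ℝ≥0∞ :=
  ∫⁻ p, cost ℓ p.1 p.2 ∂γ

/-- `γ` minimizes `C` over `Γ(μ, ν)`. -/
def IsOptimalPlan {d : ℕ} (ℓ : ℝ≥0∞ → ℝ≥0∞) (μ ν : Measure (E d))
    (γ : Measure (E d × E d)) : Prop :=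
  IsPlan μ ν γ ∧ ∀ γ' : Measure (E d × E d), IsPlan μ ν γ' → planCost ℓ γ ≤ planCost ℓ γ'

/-- `T` is a Borel map that pushes `μ` forward to `ν`. -/
def IsTransportMap {d : ℕ} (μ ν : Measure (E d)) (T : E d → E d) : Prop :=
  Measurable T ∧ μ.map T = ν

/-- The Monge functional `I[T] = ∫ c(x, T x) dμ(x)`. -/
def mapCost {d : ℕ} (ℓ : ℝ≥0∞ → ℝ≥0∞) (μ : Measure (E d)) (T : E d → E d) : ℝ≥0∞ :=
  ∫⁻ x, cost ℓ x (T x) ∂μ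

/-- `T` minimizes `I` among all transport maps from `μ` to `ν`. -/
def IsOptimalMap {d : ℕ} (ℓ : ℝ≥0∞ → ℝ≥0∞) (μ ν : Measure (E d)) (T : E d → E d) : Prop :=
  IsTransportMap μ ν T ∧
    ∀ S : E d → E d, IsTransportMap μ ν S → mapCost ℓ μ T ≤ mapCost ℓ μ S

/-- The plan `(id, T)_# μ` of a map `T`. -/
def planOfMap {d : ℕ} (μ : Measure (E d)) (T : E d → E d) : Measure (E d × E d) :=
  μ.map (fun x => (x, T x))

/-- The radial map `x ↦ g(|x|) x / |x|` (with value `0` at the origin). -/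
def radialMap {d : ℕ} (g : ℝ → ℝ) (x : E d) : E d := g ‖x‖ • (‖x‖⁻¹ • x)

/-- `r₀ = inf {|x| : x ∈ supp μ}`. -/
def innerRadius {d : ℕ} (μ : Measure (E d)) : ℝ := sInf (norm '' μ.support)

/-- `R = sup {|x| : x ∈ supp μ}`; used only if `supp μ` is bounded. -/
def outerRadius {d : ℕ} (μ : Measure (E d)) : ℝ := sSup (norm '' μ.support)

/-- The open interval `(r₀, R)` from the infimum `r₀` to the supremum `R ≤ ∞` of `|x|` over
`x ∈ supp μ`; it is `(0, ∞)` if `supp μ` is unbounded and contains the origin. -/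
def radialInterval {d : ℕ} (μ : Measure (E d)) : Set ℝ :=
  {r | (∃ x ∈ μ.support, ‖x‖ < r) ∧ ∃ y ∈ μ.support, r < ‖y‖}

end RadialTransport

end

/-! Write `F` for the distribution function of the radial law, the law of `|x|` under `μ`. It is
continuous because spheres are null.

Since `ℓ` decreases, the triangle inequality gives `c(x,y) ≥ ℓ(|x|+|y|)`, with equality exactly when
`y` points opposite to `x` (`AdmissibleCost.le_cost`, `AdmissibleCost.norm_sub_eq_of_cost_eq`). This
leaves a problem about radii. By the fundamental theorem of calculus, `ℓ(r+s) = L + ∫_{a>r} -ℓ'(a+s)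
da`, so by Tonelli the reduced cost of a plan `γ` is `L` plus the integral over `a` of `∫_{|x|<a}
-ℓ'(a+|y|) dγ`.

For fixed `a`, the event `|x|<a` has prescribed mass `F(a)`, the law of `y` is prescribed, and `-ℓ'`
is strictly decreasing by strict convexity. By the bathtub principle the best event is `|y|>b` with
`F(b) = 1-F(a)`. The antitone rearrangement of the radii achieves this for all `a` at once
(`AdmissibleCost.shellCost_antiMap_le`), and reversing directions makes the triangle inequality
sharp. Radial symmetry of the density makes the resulting map preserve `μ`.

A plan of no larger cost turns every inequality into an equality, because the optimal cost is
finite. Equality in the bathtub for almost every `a` forces `F(|y|) = 1-F(|x|)`, and equality in the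
triangle inequality fixes the direction (`AdmissibleCost.eq_planOfMap_of_planCost_le`). -/

noncomputable section

namespace RadialTransport

open ProbabilityTheory

/-! ### Antitone rearrangement of an atomless law on the line -/

section Line

variable (ν : Measure ℝ)

/-- The set where the distribution function lies strictly between `0` and `1`. -/
def massInterval : Set ℝ := {r | 0 < cdf ν r ∧ cdf ν r < 1}

/-- The antitone rearrangement of `ν` onto itself. -/
def antiRearr (r : ℝ) : ℝ :=
  open Classical in if r ∈ massInterval ν then sInf {s | 1 ≤ cdf ν r + cdf ν s} else 0

variable {ν}

lemma continuous_cdf [IsProbabilityMeasure ν] [NullSingletonClass ν] : Continuous (cdf ν) := by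
  rw [continuous_iff_continuousAt]
  intro a
  rw [(monotone_cdf ν).continuousAt_iff_leftLim_eq_rightLim, StieltjesFunction.rightLim_eq]
  have h := (cdf ν).measure_singleton a
  rw [measure_cdf, measure_singleton, eq_comm, ENNReal.ofReal_eq_zero] at h
  exact le_antisymm ((monotone_cdf ν).leftLim_le le_rfl) (by linarith)

/-- Continuity of the distribution function makes the defining set closed, so its infimum is
attained; membership in the mass interval makes it nonempty and bounded below. This equivalence
drives the other properties of the rearrangement. -/
lemma antiRearr_le_iff [IsProbabilityMeasure ν] [NullSingletonClass ν] {r : ℝ} (hr : r ∈ massInterval ν)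
    {s : ℝ} : antiRearr ν r ≤ s ↔ 1 ≤ cdf ν r + cdf ν s := by
  have hne : {s | 1 ≤ cdf ν r + cdf ν s}.Nonempty := by
    have h := (tendsto_cdf_atTop ν).eventually_const_lt (u := 1 - cdf ν r) (by linarith [hr.1])
    obtain ⟨s, hs⟩ := h.exists
    exact ⟨s, by simp only [mem_ofPred_eq]; linarith⟩
  have hbdd : BddBelow {s | 1 ≤ cdf ν r + cdf ν s} := by
    have h := (tendsto_cdf_atBot ν).eventually_lt_const (u := 1 - cdf ν r) (by linarith [hr.2])
    obtain ⟨b, hb⟩ := h.exists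
    refine ⟨b, fun s hs => ?_⟩
    by_contra! hsb
    have := monotone_cdf ν hsb.le
    simp only [mem_ofPred_eq] at hs
    linarith
  have hcl : IsClosed {s | 1 ≤ cdf ν r + cdf ν s} :=
    isClosed_le continuous_const (continuous_const.add continuous_cdf)
  have hmem := hcl.csInf_mem hne hbdd
  rw [antiRearr, if_pos hr]
  constructor
  · intro h
    have h1 : 1 ≤ cdf ν r + cdf ν (sInf {s | 1 ≤ cdf ν r + cdf ν s}) := hmem
    linarith [monotone_cdf ν h]
  · exact fun h => csInf_le hbdd h

lemma cdf_antiRearr [IsProbabilityMeasure ν] [NullSingletonClass ν] {r : ℝ} (hr : r ∈ massInterval ν) :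
    cdf ν (antiRearr ν r) = 1 - cdf ν r := by
  have h1 := (antiRearr_le_iff hr).1 le_rfl
  refine le_antisymm ?_ (by linarith)
  refine le_of_tendsto (x := 𝓝[<] antiRearr ν r)
    (continuous_cdf.continuousAt.tendsto.mono_left nhdsWithin_le_nhds) ?_
  filter_upwards [self_mem_nhdsWithin] with s hs
  have := (antiRearr_le_iff hr (s := s)).not.1 (not_le.2 hs)
  linarith

lemma antiRearr_mem [IsProbabilityMeasure ν] [NullSingletonClass ν] {r : ℝ} (hr : r ∈ massInterval ν) :
    antiRearr ν r ∈ massInterval ν := by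
  simp only [massInterval, mem_ofPred_eq, cdf_antiRearr hr]
  exact ⟨by linarith [hr.2], by linarith [hr.1]⟩

/-- The condition `1 ≤ F(r) + F(s)` is symmetric, so the rearrangement is its own generalized
inverse; this is why it preserves `ν`. -/
lemma antiRearr_le_iff_le [IsProbabilityMeasure ν] [NullSingletonClass ν] {r s : ℝ}
    (hr : r ∈ massInterval ν) (hs : s ∈ massInterval ν) :
    antiRearr ν r ≤ s ↔ antiRearr ν s ≤ r := by
  rw [antiRearr_le_iff hr, antiRearr_le_iff hs, add_comm]

lemma antitoneOn_antiRearr [IsProbabilityMeasure ν] [NullSingletonClass ν] :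
    AntitoneOn (antiRearr ν) (massInterval ν) := by
  intro r hr s hs hrs
  rw [antiRearr_le_iff hs, cdf_antiRearr hr]
  linarith [monotone_cdf ν hrs]

lemma antiRearr_lt_of_cdf_lt [IsProbabilityMeasure ν] [NullSingletonClass ν] {r s : ℝ}
    (hr : r ∈ massInterval ν) (hs : s ∈ massInterval ν) (h : cdf ν r < cdf ν s) :
    antiRearr ν s < antiRearr ν r := by
  by_contra! hle
  have := monotone_cdf ν hle
  rw [cdf_antiRearr hr, cdf_antiRearr hs] at this
  linarith

lemma measurableSet_massInterval [IsProbabilityMeasure ν] : MeasurableSet (massInterval ν) :=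
  (measurableSet_lt measurable_const (monotone_cdf ν).measurable).inter
    (measurableSet_lt (monotone_cdf ν).measurable measurable_const)

lemma measurable_antiRearr [IsProbabilityMeasure ν] [NullSingletonClass ν] : Measurable (antiRearr ν) := by
  refine measurable_of_Iic fun s => ?_
  have : antiRearr ν ⁻¹' Iic s =
      (massInterval ν ∩ {r | 1 ≤ cdf ν r + cdf ν s}) ∪ ((massInterval ν)ᶜ ∩ {_r | 0 ≤ s}) := by
    ext r
    by_cases hr : r ∈ massInterval ν
    · simp [hr, antiRearr_le_iff hr]
    · simp [hr, antiRearr]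
  rw [this]
  refine (measurableSet_massInterval.inter ?_).union
    (measurableSet_massInterval.compl.inter (.const _))
  exact measurableSet_le measurable_const ((monotone_cdf ν).measurable.add_const _)

/-- Outside the mass interval the default value `0` is what makes this hold at every `r`. -/
lemma antiRearr_nonneg [IsProbabilityMeasure ν] [NullSingletonClass ν] (h0 : ∀ r ≤ 0, cdf ν r = 0) (r : ℝ) :
    0 ≤ antiRearr ν r := by
  by_cases hr : r ∈ massInterval ν
  · by_contra! h
    exact (antiRearr_mem hr).1.ne' (h0 _ h.le)
  · simp [antiRearr, hr]

lemma antiRearr_pos [IsProbabilityMeasure ν] [NullSingletonClass ν] (h0 : ∀ r ≤ 0, cdf ν r = 0) {r : ℝ}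
    (hr : r ∈ massInterval ν) : 0 < antiRearr ν r := by
  by_contra! h
  exact (antiRearr_mem hr).1.ne' (h0 _ h)

/-- A compact part of a level set lies between its least and greatest points, and the interval
between them has mass `c - c = 0`. -/
lemma measure_cdf_level [IsProbabilityMeasure ν] [NullSingletonClass ν] (c : ℝ) :
    ν {r | cdf ν r = c} = 0 := by
  by_contra h
  have hm : MeasurableSet {r | cdf ν r = c} :=
    measurableSet_eq_fun (monotone_cdf ν).measurable measurable_const
  obtain ⟨K, hKs, hK, hpos⟩ := hm.exists_lt_isCompact (μ := ν) (pos_iff_ne_zero.2 h)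
  rcases K.eq_empty_or_nonempty with rfl | hne
  · simp at hpos
  have ha : cdf ν (sInf K) = c := hKs (hK.sInf_mem hne)
  have hb : cdf ν (sSup K) = c := hKs (hK.sSup_mem hne)
  have hsub : K ⊆ Icc (sInf K) (sSup K) :=
    fun x hx => ⟨csInf_le hK.bddBelow hx, le_csSup hK.bddAbove hx⟩
  have h2 : ν (Icc (sInf K) (sSup K)) = 0 := by
    rw [← measure_congr (Ioc_ae_eq_Icc (μ := ν)), ← measure_cdf ν, StieltjesFunction.measure_Ioc,
      ha, hb]
    simp
  exact hpos.ne' (measure_mono_null hsub h2)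

lemma ae_cdf_ne [IsProbabilityMeasure ν] [NullSingletonClass ν] (c : ℝ) : ∀ᵐ r ∂ν, cdf ν r ≠ c := by
  rw [ae_iff]
  simpa using measure_cdf_level (ν := ν) c

lemma ae_mem_massInterval [IsProbabilityMeasure ν] [NullSingletonClass ν] : ∀ᵐ r ∂ν, r ∈ massInterval ν := by
  filter_upwards [ae_cdf_ne (ν := ν) 0, ae_cdf_ne (ν := ν) 1] with r h0 h1
  exact ⟨(cdf_nonneg ν r).lt_of_ne' h0, (cdf_le_one ν r).lt_of_ne h1⟩

/-- Two points at the same level enclose a rational at that level. Discarding the countably many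
levels of rationals costs only a null set. -/
lemma exists_ae_injOn_cdf [IsProbabilityMeasure ν] [NullSingletonClass ν] :
    ∃ S : Set ℝ, (∀ᵐ r ∂ν, r ∈ S) ∧ InjOn (cdf ν) S := by
  refine ⟨{r | ∀ q : ℚ, cdf ν r ≠ cdf ν q}, ae_all_iff.2 fun q => ae_cdf_ne _, ?_⟩
  have key : ∀ r, (∀ q : ℚ, cdf ν r ≠ cdf ν q) → ∀ s, r < s → cdf ν r < cdf ν s := by
    intro r hr s hrs
    obtain ⟨q, hq1, hq2⟩ := exists_rat_btwn hrs
    exact ((monotone_cdf ν hq1.le).lt_of_ne (hr q)).trans_le (monotone_cdf ν hq2.le)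
  intro r hr s hs h
  rcases lt_trichotomy r s with h1 | h1 | h1
  · exact absurd h (key r hr s h1).ne
  · exact h1
  · exact absurd h (key s hs r h1).ne'

lemma measure_Iio_eq_cdf [IsProbabilityMeasure ν] [NullSingletonClass ν] (r : ℝ) :
    ν (Iio r) = ENNReal.ofReal (cdf ν r) := by
  rw [ofReal_cdf, measure_congr Iio_ae_eq_Iic]

lemma measure_Ici_eq_cdf [IsProbabilityMeasure ν] [NullSingletonClass ν] (r : ℝ) :
    ν (Ici r) = ENNReal.ofReal (1 - cdf ν r) := by
  rw [← compl_Iio, prob_compl_eq_one_sub measurableSet_Iio, measure_Iio_eq_cdf,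
    ENNReal.ofReal_sub _ (cdf_nonneg ν r), ENNReal.ofReal_one]

lemma measure_Ioi_eq_cdf [IsProbabilityMeasure ν] [NullSingletonClass ν] (r : ℝ) :
    ν (Ioi r) = ENNReal.ofReal (1 - cdf ν r) := by
  rw [measure_congr Ioi_ae_eq_Ici, measure_Ici_eq_cdf]

lemma map_antiRearr [IsProbabilityMeasure ν] [NullSingletonClass ν] : ν.map (antiRearr ν) = ν := by
  have : IsProbabilityMeasure (ν.map (antiRearr ν)) :=
    Measure.isProbabilityMeasure_map measurable_antiRearr.aemeasurable
  refine Measure.ext_of_Iic _ _ fun s => ?_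
  rw [Measure.map_apply measurable_antiRearr measurableSet_Iic, ← ofReal_cdf]
  by_cases hs : s ∈ massInterval ν
  · have h : (antiRearr ν ⁻¹' Iic s : Set ℝ) =ᵐ[ν] Ici (antiRearr ν s) := by
      filter_upwards [ae_mem_massInterval (ν := ν)] with r hr
      exact propext (antiRearr_le_iff_le hr hs)
    rw [measure_congr h, measure_Ici_eq_cdf, cdf_antiRearr hs]
    simp
  · have h01 : cdf ν s = 0 ∨ cdf ν s = 1 := by
      by_contra! hc
      exact hs ⟨(cdf_nonneg ν s).lt_of_ne' hc.1, (cdf_le_one ν s).lt_of_ne hc.2⟩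
    rcases h01 with h | h
    · rw [h, ENNReal.ofReal_zero]
      refine measure_eq_zero_iff_ae_notMem.2 ?_
      filter_upwards [ae_mem_massInterval (ν := ν)] with r hr hrs
      have := (antiRearr_le_iff hr).1 hrs
      linarith [hr.2]
    · rw [h, ENNReal.ofReal_one, ← measure_univ (μ := ν)]
      refine measure_congr ?_
      filter_upwards [ae_mem_massInterval (ν := ν)] with r hr
      refine eq_true ((antiRearr_le_iff hr).2 ?_)
      linarith [hr.1]

/-- Points to the left of `a` are exactly those sent beyond the image of `a`. -/
lemma ae_lt_iff_antiRearr_lt [IsProbabilityMeasure ν] [NullSingletonClass ν] {a : ℝ}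
    (ha : a ∈ massInterval ν) : ∀ᵐ r ∂ν, r < a ↔ antiRearr ν a < antiRearr ν r := by
  filter_upwards [ae_mem_massInterval (ν := ν), ae_cdf_ne (ν := ν) (cdf ν a)] with r hr hne
  refine ⟨fun h => antiRearr_lt_of_cdf_lt hr ha ((monotone_cdf ν h.le).lt_of_ne hne), fun h => ?_⟩
  by_contra! hle
  exact absurd (antitoneOn_antiRearr ha hr hle) (not_le.2 h)

/-- The filter is left general so that finite and infinite endpoints are treated together. -/
lemma eventually_lt_antiRearr [IsProbabilityMeasure ν] [NullSingletonClass ν] {l : Filter ℝ}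
    (hI : ∀ᶠ r in l, r ∈ massInterval ν) (hF : Tendsto (cdf ν) l (𝓝 0)) {c : ℝ}
    (hc : cdf ν c < 1) : ∀ᶠ r in l, c < antiRearr ν r := by
  filter_upwards [hI, hF.eventually_lt_const (u := 1 - cdf ν c) (by linarith)] with r hr h
  by_contra! hle
  linarith [(antiRearr_le_iff hr).1 hle]

lemma eventually_antiRearr_le [IsProbabilityMeasure ν] [NullSingletonClass ν] {l : Filter ℝ}
    (hI : ∀ᶠ r in l, r ∈ massInterval ν) (hF : Tendsto (cdf ν) l (𝓝 1)) {c : ℝ}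
    (hc : 0 < cdf ν c) : ∀ᶠ r in l, antiRearr ν r ≤ c := by
  filter_upwards [hI, hF.eventually_const_lt (u := 1 - cdf ν c) (by linarith)] with r hr h
  exact (antiRearr_le_iff hr).2 (by linarith)

lemma tendsto_antiRearr_atTop [IsProbabilityMeasure ν] [NullSingletonClass ν] {l : Filter ℝ}
    (hI : ∀ᶠ r in l, r ∈ massInterval ν) (hF : Tendsto (cdf ν) l (𝓝 0))
    (h1 : ∀ c, cdf ν c < 1) : Tendsto (antiRearr ν) l atTop :=
  tendsto_atTop.2 fun c => (eventually_lt_antiRearr hI hF (h1 c)).mono fun _ h => h.le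

lemma tendsto_antiRearr_sup [IsProbabilityMeasure ν] [NullSingletonClass ν] {l : Filter ℝ}
    (hI : ∀ᶠ r in l, r ∈ massInterval ν) (hF : Tendsto (cdf ν) l (𝓝 0)) {R : ℝ}
    (hR : cdf ν R = 1) (h1 : ∀ c < R, cdf ν c < 1) : Tendsto (antiRearr ν) l (𝓝 R) := by
  refine tendsto_order.2 ⟨fun c hc => eventually_lt_antiRearr hI hF (h1 c hc), fun c hc => ?_⟩
  filter_upwards [hI] with r hr
  by_contra! h
  have := monotone_cdf ν (hc.le.trans h)
  linarith [(antiRearr_mem hr).2]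

lemma tendsto_antiRearr_inf [IsProbabilityMeasure ν] [NullSingletonClass ν] {l : Filter ℝ}
    (hI : ∀ᶠ r in l, r ∈ massInterval ν) (hF : Tendsto (cdf ν) l (𝓝 1)) {r₀ : ℝ}
    (hr₀ : cdf ν r₀ = 0) (h0 : ∀ c, r₀ < c → 0 < cdf ν c) :
    Tendsto (antiRearr ν) l (𝓝 r₀) := by
  refine tendsto_order.2 ⟨fun c hc => ?_, fun c hc => ?_⟩
  · filter_upwards [hI] with r hr
    by_contra! h
    have := monotone_cdf ν (h.trans hc.le)
    linarith [(antiRearr_mem hr).1]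
  · obtain ⟨c', h1, h2⟩ := exists_between hc
    exact (eventually_antiRearr_le hI hF (h0 c' h1)).mono fun r h => h.trans_lt h2

end Line

/-! ### Polar coordinates and radial densities -/

section Polar

variable {V : Type*} [NormedAddCommGroup V] [NormedSpace ℝ V]

/-- Polar coordinates `(ω, r) ↦ r ω`. -/
def polarMap (V : Type*) [NormedAddCommGroup V] [NormedSpace ℝ V]
    (p : Metric.sphere (0 : V) 1 × Ioi (0 : ℝ)) : V := p.2.1 • p.1.1

lemma continuous_polarMap : Continuous (polarMap V) := by
  unfold polarMap
  fun_prop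

lemma norm_polarMap (p : Metric.sphere (0 : V) 1 × Ioi (0 : ℝ)) : ‖polarMap V p‖ = p.2.1 := by
  have h1 : ‖p.1.1‖ = 1 := by simp
  have h2 : 0 < p.2.1 := p.2.2
  rw [polarMap, norm_smul, h1, mul_one, Real.norm_of_nonneg h2.le]

variable [MeasurableSpace V] [BorelSpace V] [FiniteDimensional ℝ V]

lemma map_polarMap [Nontrivial V] (m : Measure V) [m.IsAddHaarMeasure] :
    (m.toSphere.prod (Measure.volumeIoiPow (Module.finrank ℝ V - 1))).map (polarMap V) = m := by
  have hp := m.measurePreserving_homeomorphUnitSphereProd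
  have h1 : polarMap V = Subtype.val ∘ (homeomorphUnitSphereProd V).symm := by
    ext p
    simp [polarMap]
  rw [h1, ← Measure.map_map measurable_subtype_coe (homeomorphUnitSphereProd V).symm.measurable,
    ← hp.map_eq, Measure.map_map (homeomorphUnitSphereProd V).symm.measurable
      (homeomorphUnitSphereProd V).measurable]
  simp only [Homeomorph.symm_comp_self, Measure.map_id]
  rw [map_comap_subtype_coe (measurableSet_singleton _).compl]
  -- The polar homeomorphism misses only the origin, a null point.
  exact Measure.restrict_eq_self_of_ae_mem (by simp [ae_iff])

lemma exists_polar_withDensity [Nontrivial V] (m : Measure V) [m.IsAddHaarMeasure] {ρ : V → ℝ≥0}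
    (hρ : Measurable ρ) (lam : ℝ → ℝ≥0) (hrad : ∀ x, ρ x = lam ‖x‖) :
    ∃ κ : Measure (Ioi (0 : ℝ)), SFinite κ ∧
      (m.toSphere.prod κ).map (polarMap V) = m.withDensity (fun x => (ρ x : ℝ≥0∞)) := by
  -- Measurability of `lam` is not assumed; on `(0, ∞)` it is read off from `ρ` along a ray through
  -- a unit vector.
  obtain ⟨e, he⟩ := exists_norm_eq V zero_le_one
  have hlam : Measurable fun r : Ioi (0 : ℝ) => (lam r.1 : ℝ≥0∞) := by
    have : (fun r : Ioi (0 : ℝ) => (lam r.1 : ℝ≥0∞)) = fun r => (ρ (r.1 • e) : ℝ≥0∞) := by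
      ext r
      have : 0 < r.1 := r.2
      rw [hrad, norm_smul, he, mul_one, Real.norm_of_nonneg this.le]
    rw [this]
    have : Measurable fun r : Ioi (0 : ℝ) => r.1 • e := by fun_prop
    exact (hρ.comp this).coe_nnreal_ennreal
  refine ⟨(Measure.volumeIoiPow (Module.finrank ℝ V - 1)).withDensity fun r => (lam r.1 : ℝ≥0∞),
    inferInstance, ?_⟩
  rw [prod_withDensity_right hlam]
  have hm : Measurable (polarMap V) := continuous_polarMap.measurable
  ext s hs
  rw [Measure.map_apply hm hs, withDensity_apply _ (hm hs), withDensity_apply _ hs]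
  conv_rhs => rw [← map_polarMap m]
  rw [setLIntegral_map hs hρ.coe_nnreal_ennreal hm]
  simp [hrad, norm_polarMap]

/-- A radial density is carried to itself by every radial rearrangement that preserves the law of
the norm. -/
lemma map_radial_eq [Nontrivial V] (m : Measure V) [m.IsAddHaarMeasure] {ρ : V → ℝ≥0}
    (hρ : Measurable ρ) (lam : ℝ → ℝ≥0) (hrad : ∀ x, ρ x = lam ‖x‖) {μ : Measure V}
    (hμ : μ = m.withDensity (fun x => (ρ x : ℝ≥0∞))) {G : ℝ → ℝ} (hG : Measurable G)
    (hpos : ∀ᵐ x ∂μ, 0 < G ‖x‖) (hmap : (μ.map norm).map G = μ.map norm) :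
    μ.map (fun x => G ‖x‖ • (‖x‖⁻¹ • x)) = μ := by
  obtain ⟨κ, hκ, hκμ⟩ := exists_polar_withDensity m hρ lam hrad
  rw [← hμ] at hκμ
  set σ := m.toSphere
  have hP : Measurable (polarMap V) := continuous_polarMap.measurable
  have hval : Measurable (Subtype.val : Ioi (0 : ℝ) → ℝ) := measurable_subtype_coe
  have hσ : σ univ ≠ 0 := by
    rw [Ne, Measure.measure_univ_eq_zero]
    exact m.toSphere_ne_zero
  have hσ' : σ univ ≠ ∞ := measure_ne_top _ _
  have hnorm : μ.map norm = σ univ • κ.map Subtype.val := by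
    rw [← hκμ, Measure.map_map measurable_norm hP]
    have : norm ∘ polarMap V = Subtype.val ∘ Prod.snd := by
      ext p
      exact norm_polarMap p
    rw [this, ← Measure.map_map hval measurable_snd, Measure.map_snd_prod, Measure.map_smul]
  -- The law of the norm is `κ` times the finite nonzero area of the sphere, which cancels.
  have hκG : (κ.map Subtype.val).map G = κ.map Subtype.val := by
    rw [hnorm, Measure.map_smul] at hmap
    ext s hs
    have := congrArg (fun ν : Measure ℝ => ν s) hmap
    simp only [Measure.smul_apply, smul_eq_mul] at this
    exact (ENNReal.mul_right_inj hσ hσ').1 this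
  have hpos' : ∀ᵐ r ∂κ, 0 < G r.1 := by
    have h1 : ∀ᵐ r ∂(μ.map norm), 0 < G r :=
      (ae_map_iff measurable_norm.aemeasurable (measurableSet_lt measurable_const hG)).2 hpos
    rw [hnorm, Measure.ae_ennreal_smul_measure_iff hσ] at h1
    exact ae_of_ae_map hval.aemeasurable h1
  -- The value `1` on the null set where `G ≤ 0` turns `G` into a self-map of `(0, ∞)`.
  let G' : Ioi (0 : ℝ) → Ioi (0 : ℝ) := fun r =>
    ⟨if 0 < G r.1 then G r.1 else 1, by
      split_ifs with h
      exacts [h, mem_Ioi.2 one_pos]⟩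
  have hG'val : ∀ r, 0 < G r.1 → (G' r).1 = G r.1 := fun r h => by simp [G', h]
  have hG' : Measurable G' := by
    refine Measurable.subtype_mk (Measurable.ite ?_ (hG.comp hval) measurable_const)
    exact measurableSet_lt measurable_const (hG.comp hval)
  have hκG' : κ.map G' = κ := by
    have hemb : MeasurableEmbedding (Subtype.val : Ioi (0 : ℝ) → ℝ) :=
      MeasurableEmbedding.subtype_coe measurableSet_Ioi
    have : (κ.map G').map Subtype.val = κ.map Subtype.val := by
      rw [Measure.map_map hval hG', ← hκG, Measure.map_map hG hval]
      refine Measure.map_congr ?_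
      filter_upwards [hpos'] with r hr
      exact hG'val r hr
    rw [← hemb.comap_map (κ.map G'), this, hemb.comap_map]
  have hT : Measurable fun x : V => G ‖x‖ • (‖x‖⁻¹ • x) := by fun_prop
  have hcongr : (fun x : V => G ‖x‖ • (‖x‖⁻¹ • x)) ∘ polarMap V
      =ᵐ[σ.prod κ] polarMap V ∘ Prod.map id G' := by
    have h2 : ∀ᵐ p ∂(σ.prod κ), 0 < G p.2.1 := Measure.quasiMeasurePreserving_snd.ae hpos'
    filter_upwards [h2] with p hp
    have h3 : p.2.1 ≠ 0 := (show 0 < p.2.1 from p.2.2).ne'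
    simp only [Function.comp_apply, norm_polarMap]
    simp only [polarMap, Prod.map_fst, Prod.map_snd, id, hG'val _ hp, smul_smul]
    rw [inv_mul_cancel₀ h3, mul_one]
  rw [← hκμ, Measure.map_map hT hP, Measure.map_congr hcongr,
    ← Measure.map_map hP (measurable_id.prodMap hG'), ← Measure.map_prod_map _ _ measurable_id hG',
    hκG', Measure.map_id]

lemma map_neg_withDensity_radial (m : Measure V) [m.IsAddHaarMeasure] {ρ : V → ℝ≥0}
    (lam : ℝ → ℝ≥0) (hrad : ∀ x, ρ x = lam ‖x‖) {μ : Measure V}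
    (hμ : μ = m.withDensity (fun x => (ρ x : ℝ≥0∞))) : μ.map Neg.neg = μ := by
  have hmp : MeasurePreserving (Neg.neg : V → V) m m := Measure.measurePreserving_neg m
  ext s hs
  rw [Measure.map_apply measurable_neg hs, hμ, withDensity_apply _ (measurable_neg hs),
    withDensity_apply _ hs, ← hmp.setLIntegral_comp_preimage_emb
      (MeasurableEquiv.neg V).measurableEmbedding]
  simp [hrad]

end Polar

/-! ### The bathtub principle -/

section Bathtub

variable {α : Type*} [MeasurableSpace α] {γ : Measure α} {A B : Set α} {φ : α → ℝ≥0∞} {c : ℝ≥0∞}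

/-- Among the sets of given measure, a sublevel set of `φ` minimizes the integral of `φ`. -/
lemma setLIntegral_sublevel_le [IsFiniteMeasure γ] (hA : MeasurableSet A) (hB : MeasurableSet B)
    (hAB : γ A = γ B) (hlt : ∀ x ∈ B, φ x ≤ c) (hge : ∀ x ∉ B, c ≤ φ x) :
    ∫⁻ x in B, φ x ∂γ ≤ ∫⁻ x in A, φ x ∂γ := by
  -- The common part drops out; `B \ A` and `A \ B` have equal mass, with `φ ≤ c` on one and `φ ≥ c`
  -- on the other.
  rw [← lintegral_inter_add_sdiff φ B hA, ← lintegral_inter_add_sdiff φ A hB, inter_comm]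
  have hdiff := measure_sdiff_symm hB.nullMeasurableSet hA.nullMeasurableSet hAB.symm
    (measure_ne_top _ _)
  refine add_le_add le_rfl ?_
  calc ∫⁻ x in B \ A, φ x ∂γ ≤ ∫⁻ _ in B \ A, c ∂γ :=
        setLIntegral_mono' (hB.diff hA) fun x hx => hlt x hx.1
    _ = c * γ (A \ B) := by
        rw [setLIntegral_const, hdiff]
    _ = ∫⁻ _ in A \ B, c ∂γ := (setLIntegral_const _ _).symm
    _ ≤ ∫⁻ x in A \ B, φ x ∂γ := setLIntegral_mono' (hA.diff hB) fun x hx => hge x hx.2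

/-- The minimizing set is unique up to null sets. -/
lemma ae_mem_iff_of_setLIntegral_le [IsFiniteMeasure γ] (hA : MeasurableSet A)
    (hB : MeasurableSet B) (hAB : γ A = γ B) (hc : c ≠ ∞)
    (hlt : ∀ x ∈ B, φ x < c) (hge : ∀ x ∉ B, c ≤ φ x)
    (hle : ∫⁻ x in A, φ x ∂γ ≤ ∫⁻ x in B, φ x ∂γ) : ∀ᵐ x ∂γ, x ∈ A ↔ x ∈ B := by
  have hdiff := measure_sdiff_symm hB.nullMeasurableSet hA.nullMeasurableSet hAB.symm
    (measure_ne_top _ _)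
  have hfin : ∀ s ⊆ B, MeasurableSet s → ∫⁻ x in s, φ x ∂γ ≠ ∞ := fun s hs hsm => by
    refine ((setLIntegral_mono' hsm fun x hx => (hlt x (hs hx)).le).trans_lt ?_).ne
    rw [setLIntegral_const]
    exact ENNReal.mul_lt_top hc.lt_top (measure_lt_top _ _)
  rw [← lintegral_inter_add_sdiff φ B hA, ← lintegral_inter_add_sdiff φ A hB, inter_comm,
    ENNReal.add_le_add_iff_left (hfin _ inter_subset_left (hB.inter hA))] at hle
  have hnull : γ (B \ A) = 0 := by
    by_contra h0
    have h1 : ∫⁻ x in B \ A, φ x ∂γ < ∫⁻ _ in B \ A, c ∂γ :=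
      setLIntegral_strict_mono (hB.diff hA) h0 measurable_const
        (hfin _ sdiff_subset (hB.diff hA)) (ae_of_all _ fun x hx => hlt x hx.1)
    have h2 : ∫⁻ _ in A \ B, c ∂γ ≤ ∫⁻ x in A \ B, φ x ∂γ :=
      setLIntegral_mono' (hA.diff hB) fun x hx => hge x hx.2
    rw [setLIntegral_const] at h1 h2
    rw [hdiff] at h1
    exact absurd (h2.trans hle) (not_le.2 h1)
  have hnull' : γ (A \ B) = 0 := hdiff ▸ hnull
  filter_upwards [measure_eq_zero_iff_ae_notMem.1 hnull, measure_eq_zero_iff_ae_notMem.1 hnull']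
    with x h1 h2
  simp only [Set.mem_sdiff, not_and, not_not] at h1 h2
  exact ⟨h2, h1⟩

end Bathtub

/-! ### The profile as an integral of its decay rate -/

section Profile

variable {d : ℕ} {ℓ : ℝ≥0∞ → ℝ≥0∞}

/-- The rate of decay of the profile. -/
def decay (ℓ : ℝ≥0∞ → ℝ≥0∞) (t : ℝ) : ℝ≥0∞ := ENNReal.ofReal (-deriv (realProfile ℓ) t)

lemma measurable_decay : Measurable (decay ℓ) := (measurable_deriv _).neg.ennreal_ofReal

lemma decay_ne_top (t : ℝ) : decay ℓ t ≠ ∞ := ENNReal.ofReal_ne_top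

lemma AdmissibleCost.differentiableAt (hℓ : AdmissibleCost d ℓ) {t : ℝ} (ht : 0 < t) :
    DifferentiableAt ℝ (realProfile ℓ) t :=
  (hℓ.contDiff.differentiableOn one_ne_zero).differentiableAt (Ioi_mem_nhds ht)

lemma AdmissibleCost.deriv_nonpos (hℓ : AdmissibleCost d ℓ) {t : ℝ} (ht : 0 < t) :
    deriv (realProfile ℓ) t ≤ 0 := by
  rw [← derivWithin_of_isOpen isOpen_Ioi (mem_Ioi.2 ht)]
  exact hℓ.strictAnti.antitoneOn.derivWithin_nonpos

lemma AdmissibleCost.strictAntiOn_decay (hℓ : AdmissibleCost d ℓ) :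
    StrictAntiOn (decay ℓ) (Ioi 0) := by
  intro s hs t ht hst
  have h := hℓ.strictConvex.strictMonoOn_deriv (fun x hx => hℓ.differentiableAt hx) hs ht hst
  -- Since `-ℓ'(s) > -ℓ'(t) ≥ 0`, truncation by `ENNReal.ofReal` keeps the inequality strict.
  have h0 := hℓ.deriv_nonpos ht
  exact (ENNReal.ofReal_lt_ofReal_iff (by linarith)).2 (by linarith)

lemma AdmissibleCost.ofReal_realProfile (hℓ : AdmissibleCost d ℓ) {t : ℝ} (ht : 0 < t) :
    ENNReal.ofReal (realProfile ℓ t) = ℓ (ENNReal.ofReal t) :=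
  ENNReal.ofReal_toReal (hℓ.finite t ht)

lemma AdmissibleCost.exists_tendsto (hℓ : AdmissibleCost d ℓ) :
    ∃ L : ℝ, 0 ≤ L ∧ (∀ t, 0 < t → L ≤ realProfile ℓ t) ∧
      Tendsto (realProfile ℓ) atTop (𝓝 L) := by
  -- The maximum with `1` keeps the argument in `(0, ∞)`, where monotonicity is available.
  have hanti : Antitone fun t => realProfile ℓ (max t 1) := fun s t hst =>
    hℓ.strictAnti.antitoneOn (by simp) (by simp) (max_le_max_right 1 hst)
  have hbdd : BddBelow (range fun t => realProfile ℓ (max t 1)) :=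
    ⟨0, by rintro _ ⟨t, rfl⟩; exact ENNReal.toReal_nonneg⟩
  have hlim := tendsto_atTop_ciInf hanti hbdd
  have hlim' : Tendsto (realProfile ℓ) atTop (𝓝 (⨅ t, realProfile ℓ (max t 1))) := by
    refine hlim.congr' ?_
    filter_upwards [eventually_ge_atTop 1] with t ht
    rw [max_eq_left ht]
  refine ⟨_, le_ciInf fun t => ENNReal.toReal_nonneg, fun t ht => ?_, hlim'⟩
  refine le_of_tendsto hlim' ?_
  filter_upwards [eventually_ge_atTop t] with s hs
  exact hℓ.strictAnti.antitoneOn ht (lt_of_lt_of_le ht hs) hs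

lemma AdmissibleCost.exists_eq_add_lintegral_decay (hℓ : AdmissibleCost d ℓ) :
    ∃ L : ℝ≥0∞, L ≠ ∞ ∧ ∀ r s : ℝ, 0 < r + s →
      ℓ (ENNReal.ofReal (r + s)) = L + ∫⁻ a in Ioi r, decay ℓ (a + s) := by
  obtain ⟨L, hL0, hLle, hL⟩ := hℓ.exists_tendsto
  refine ⟨ENNReal.ofReal L, ENNReal.ofReal_ne_top, fun r s hrs => ?_⟩
  have hder : ∀ a ∈ Ici r, HasDerivAt (fun a => realProfile ℓ (a + s))
      (deriv (realProfile ℓ) (a + s)) a := fun a ha =>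
    (hℓ.differentiableAt (by linarith [mem_Ici.1 ha])).hasDerivAt.comp_add_const a s
  have hneg : ∀ a ∈ Ioi r, deriv (realProfile ℓ) (a + s) ≤ 0 := fun a ha =>
    hℓ.deriv_nonpos (by linarith [mem_Ioi.1 ha])
  have hlim : Tendsto (fun a => realProfile ℓ (a + s)) atTop (𝓝 L) :=
    hL.comp (tendsto_atTop_add_const_right _ s tendsto_id)
  have hint := integrableOn_Ioi_deriv_of_nonpos' hder hneg hlim
  have heq := integral_Ioi_of_hasDerivAt_of_nonpos' hder hneg hlim
  have h1 : ∫⁻ a in Ioi r, decay ℓ (a + s) = ENNReal.ofReal (realProfile ℓ (r + s) - L) := by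
    rw [← neg_sub, ← heq, ← integral_neg, ofReal_integral_eq_lintegral_ofReal]
    · rfl
    · exact hint.neg
    · filter_upwards [ae_restrict_mem measurableSet_Ioi] with a ha
      exact neg_nonneg.2 (hneg a ha)
  rw [h1, ← ENNReal.ofReal_add hL0 (by linarith [hLle _ hrs]), add_sub_cancel,
    hℓ.ofReal_realProfile hrs]

end Profile

/-! ### Slicing the reduced cost by radius -/

section Shell

variable {V : Type*} [NormedAddCommGroup V] [MeasurableSpace V] [BorelSpace V]
  {d : ℕ} {ℓ : ℝ≥0∞ → ℝ≥0∞}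

/-- The contribution of the radius `a` to the transport cost. -/
def shellCost (ℓ : ℝ≥0∞ → ℝ≥0∞) (γ : Measure (V × V)) (a : ℝ) : ℝ≥0∞ :=
  ∫⁻ p in {p | ‖p.1‖ < a}, decay ℓ (a + ‖p.2‖) ∂γ

lemma measurableSet_shell (a : ℝ) : MeasurableSet {p : V × V | ‖p.1‖ < a} :=
  measurableSet_lt (by fun_prop) measurable_const

lemma measurable_uncurry_shell : Measurable (Function.uncurry fun (p : V × V) (a : ℝ) =>
    {q : V × V | ‖q.1‖ < a}.indicator (fun q => decay ℓ (a + ‖q.2‖)) p) := by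
  have h : (Function.uncurry fun (p : V × V) (a : ℝ) =>
      {q : V × V | ‖q.1‖ < a}.indicator (fun q => decay ℓ (a + ‖q.2‖)) p) =
      {z : (V × V) × ℝ | ‖z.1.1‖ < z.2}.indicator fun z => decay ℓ (z.2 + ‖z.1.2‖) := by
    ext ⟨p, a⟩
    simp [indicator]
  rw [h]
  refine Measurable.indicator (measurable_decay.comp (by fun_prop)) ?_
  exact measurableSet_lt (by fun_prop) (by fun_prop)

lemma measurable_shellCost (γ : Measure (V × V)) [SFinite γ] : Measurable (shellCost ℓ γ) := by
  have : shellCost ℓ γ = fun a => ∫⁻ p,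
      {q : V × V | ‖q.1‖ < a}.indicator (fun q => decay ℓ (a + ‖q.2‖)) p ∂γ := by
    ext a
    rw [shellCost, lintegral_indicator (measurableSet_shell a)]
  rw [this]
  exact (measurable_uncurry_shell (V := V) (ℓ := ℓ)).lintegral_prod_left'

/-- Tonelli applied to the integral formula for `ℓ`. As `γ` has mass one, the constant `L` is the
same for all plans, so costs can be compared radius by radius. -/
lemma AdmissibleCost.exists_lintegral_eq (hℓ : AdmissibleCost d ℓ) :
    ∃ L : ℝ≥0∞, L ≠ ∞ ∧ ∀ (γ : Measure (V × V)) [IsProbabilityMeasure γ],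
      (∀ᵐ p ∂γ, p.1 ≠ 0) → ∫⁻ p, ℓ (ENNReal.ofReal (‖p.1‖ + ‖p.2‖)) ∂γ =
        L + ∫⁻ a in Ioi 0, shellCost ℓ γ a := by
  obtain ⟨L, hL, h⟩ := hℓ.exists_eq_add_lintegral_decay
  refine ⟨L, hL, fun γ _ hγ => ?_⟩
  have h1 : ∀ᵐ p ∂γ, ℓ (ENNReal.ofReal (‖p.1‖ + ‖p.2‖)) = L + ∫⁻ a in Ioi 0,
      {q : V × V | ‖q.1‖ < a}.indicator (fun q => decay ℓ (a + ‖q.2‖)) p := by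
    filter_upwards [hγ] with p hp
    have hp' : 0 < ‖p.1‖ := norm_pos_iff.2 hp
    rw [h _ _ (by positivity)]
    congr 1
    have : ∀ a : ℝ, {q : V × V | ‖q.1‖ < a}.indicator (fun q => decay ℓ (a + ‖q.2‖)) p =
        (Ioi ‖p.1‖).indicator (fun a => decay ℓ (a + ‖p.2‖)) a := by
      intro a
      simp [indicator]
    simp_rw [this]
    rw [setLIntegral_indicator measurableSet_Ioi]
    congr 2
    ext a
    simp only [mem_inter_iff, mem_Ioi]
    exact ⟨fun h => ⟨h, hp'.trans h⟩, fun h => h.1⟩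
  rw [lintegral_congr_ae h1, lintegral_add_left measurable_const, lintegral_const, measure_univ,
    mul_one, lintegral_lintegral_swap measurable_uncurry_shell.aemeasurable]
  simp_rw [lintegral_indicator (measurableSet_shell _)]
  rfl

end Shell

/-! ### The law of the norm and the support of `μ` -/

section RadialLaw

variable {d : ℕ} {μ : Measure (E d)}

lemma nullSingletonClass_map_norm [Nontrivial (E d)] (h : μ ≪ volume) :
    NullSingletonClass (μ.map norm) := by
  refine ⟨fun r => ?_⟩
  rw [Measure.map_apply measurable_norm (measurableSet_singleton r)]
  refine h ?_
  have : (norm ⁻¹' {r} : Set (E d)) = Metric.sphere 0 r := by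
    ext x
    simp
  rw [this]
  exact Measure.addHaar_sphere _ _ _

lemma bddBelow_norm_image (s : Set (E d)) : BddBelow (norm '' s) :=
  ⟨0, by rintro _ ⟨x, -, rfl⟩; exact norm_nonneg x⟩

lemma innerRadius_eq_zero (h0 : (0 : E d) ∈ μ.support) : innerRadius μ = 0 := by
  refine le_antisymm ?_ (Real.sInf_nonneg ?_)
  · exact csInf_le (bddBelow_norm_image _) ⟨0, h0, norm_zero⟩
  · rintro _ ⟨x, -, rfl⟩
    exact norm_nonneg x

lemma ae_ne_zero_of_map_norm [NullSingletonClass (μ.map norm)] : ∀ᵐ x ∂μ, x ≠ 0 := by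
  have h : ∀ᵐ r ∂(μ.map norm), r ≠ 0 := by simp [ae_iff]
  filter_upwards [ae_of_ae_map measurable_norm.aemeasurable h] with x hx
  exact norm_ne_zero_iff.1 hx

variable [IsProbabilityMeasure μ]

lemma support_nonempty_of_prob : (norm '' μ.support).Nonempty :=
  (Measure.nonempty_support (IsProbabilityMeasure.ne_zero μ)).image _

instance isProbabilityMeasure_map_norm : IsProbabilityMeasure (μ.map norm) :=
  Measure.isProbabilityMeasure_map measurable_norm.aemeasurable

lemma cdf_map_norm_lt_cdf {s t : ℝ} (h : 0 < μ {x | s < ‖x‖ ∧ ‖x‖ < t}) :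
    cdf (μ.map norm) s < cdf (μ.map norm) t := by
  have h1 : 0 < (μ.map norm) (Ioc s t) := by
    rw [Measure.map_apply measurable_norm measurableSet_Ioc]
    exact h.trans_le (measure_mono fun x hx => ⟨hx.1, hx.2.le⟩)
  rw [← measure_cdf (μ.map norm), StieltjesFunction.measure_Ioc, ENNReal.ofReal_pos] at h1
  linarith

variable [NullSingletonClass (μ.map norm)]

lemma ofReal_cdf_map_norm (r : ℝ) :
    ENNReal.ofReal (cdf (μ.map norm) r) = μ {x | ‖x‖ < r} := by
  rw [← measure_Iio_eq_cdf, Measure.map_apply measurable_norm measurableSet_Iio]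
  rfl

lemma ofReal_one_sub_cdf_map_norm (r : ℝ) :
    ENNReal.ofReal (1 - cdf (μ.map norm) r) = μ {x | r < ‖x‖} := by
  rw [← measure_Ioi_eq_cdf, Measure.map_apply measurable_norm measurableSet_Ioi]
  rfl

lemma cdf_map_norm_of_nonpos (r : ℝ) (hr : r ≤ 0) : cdf (μ.map norm) r = 0 := by
  have h := ofReal_cdf_map_norm (μ := μ) r
  have : {x : E d | ‖x‖ < r} = ∅ := by
    ext x
    simpa using hr.trans (norm_nonneg x)
  rw [this, measure_empty, ENNReal.ofReal_eq_zero] at h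
  exact le_antisymm h (cdf_nonneg _ _)

/-- An open set has positive mass exactly when it meets the support; without atoms, the open ball
has the mass of the closed one. -/
lemma cdf_map_norm_pos_iff {r : ℝ} :
    0 < cdf (μ.map norm) r ↔ ∃ x ∈ μ.support, ‖x‖ < r := by
  rw [← ENNReal.ofReal_pos, ofReal_cdf_map_norm]
  constructor
  · intro h
    obtain ⟨x, hx, hxs⟩ := Measure.nonempty_inter_support_of_pos h
    exact ⟨x, hxs, hx⟩
  · rintro ⟨x, hx, hxr⟩
    exact (Measure.mem_support_iff_forall x).1 hx _
      ((isOpen_lt continuous_norm continuous_const).mem_nhds hxr)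

lemma cdf_map_norm_lt_one_iff {r : ℝ} :
    cdf (μ.map norm) r < 1 ↔ ∃ x ∈ μ.support, r < ‖x‖ := by
  rw [← sub_pos, ← ENNReal.ofReal_pos, ofReal_one_sub_cdf_map_norm]
  constructor
  · intro h
    obtain ⟨x, hx, hxs⟩ := Measure.nonempty_inter_support_of_pos h
    exact ⟨x, hxs, hx⟩
  · rintro ⟨x, hx, hxr⟩
    exact (Measure.mem_support_iff_forall x).1 hx _
      ((isOpen_lt continuous_const continuous_norm).mem_nhds hxr)

lemma radialInterval_eq_massInterval : radialInterval μ = massInterval (μ.map norm) := by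
  ext r
  exact and_congr cdf_map_norm_pos_iff.symm cdf_map_norm_lt_one_iff.symm

lemma ae_norm_mem_massInterval : ∀ᵐ x ∂μ, ‖x‖ ∈ massInterval (μ.map norm) :=
  ae_of_ae_map measurable_norm.aemeasurable ae_mem_massInterval

lemma cdf_innerRadius : cdf (μ.map norm) (innerRadius μ) = 0 := by
  refine le_antisymm (not_lt.1 fun h => ?_) (cdf_nonneg _ _)
  obtain ⟨x, hx, hlt⟩ := cdf_map_norm_pos_iff.1 h
  exact absurd (csInf_le (bddBelow_norm_image _) (mem_image_of_mem norm hx)) (not_le.2 hlt)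

lemma cdf_pos_of_innerRadius_lt {c : ℝ} (hc : innerRadius μ < c) : 0 < cdf (μ.map norm) c := by
  obtain ⟨_, ⟨x, hx, rfl⟩, hlt⟩ := exists_lt_of_csInf_lt support_nonempty_of_prob hc
  exact cdf_map_norm_pos_iff.2 ⟨x, hx, hlt⟩

lemma cdf_outerRadius (hb : Bornology.IsBounded μ.support) :
    cdf (μ.map norm) (outerRadius μ) = 1 := by
  have hbdd : BddAbove (norm '' μ.support) := by
    obtain ⟨C, hC⟩ := hb.exists_norm_le
    exact ⟨C, by rintro _ ⟨x, hx, rfl⟩; exact hC x hx⟩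
  refine le_antisymm (cdf_le_one _ _) (not_lt.1 fun h => ?_)
  obtain ⟨x, hx, hlt⟩ := cdf_map_norm_lt_one_iff.1 h
  exact absurd (le_csSup hbdd (mem_image_of_mem norm hx)) (not_le.2 hlt)

lemma cdf_lt_one_of_lt_outerRadius {c : ℝ} (hc : c < outerRadius μ) :
    cdf (μ.map norm) c < 1 := by
  obtain ⟨_, ⟨x, hx, rfl⟩, hlt⟩ := exists_lt_of_lt_csSup support_nonempty_of_prob hc
  exact cdf_map_norm_lt_one_iff.2 ⟨x, hx, hlt⟩

lemma cdf_lt_one_of_not_isBounded (hb : ¬ Bornology.IsBounded μ.support) (c : ℝ) :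
    cdf (μ.map norm) c < 1 := by
  by_contra h
  refine hb (isBounded_iff_forall_norm_le.2 ⟨c, fun x hx => not_lt.1 fun hlt => h ?_⟩)
  exact cdf_map_norm_lt_one_iff.2 ⟨x, hx, hlt⟩

lemma massInterval_nonempty : (massInterval (μ.map norm)).Nonempty :=
  (ae_mem_massInterval (ν := μ.map norm)).exists

lemma eventually_mem_massInterval_nhdsGT :
    ∀ᶠ r in 𝓝[>] (innerRadius μ), r ∈ massInterval (μ.map norm) := by
  obtain ⟨i, hi⟩ := massInterval_nonempty (μ := μ)
  have h : innerRadius μ < i := by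
    by_contra! h
    linarith [monotone_cdf (μ.map norm) h, hi.1, cdf_innerRadius (μ := μ)]
  filter_upwards [Ioo_mem_nhdsGT h] with r hr
  exact ⟨cdf_pos_of_innerRadius_lt hr.1, (monotone_cdf _ hr.2.le).trans_lt hi.2⟩

lemma tendsto_cdf_nhdsGT_innerRadius :
    Tendsto (cdf (μ.map norm)) (𝓝[>] (innerRadius μ)) (𝓝 0) := by
  have h := (continuous_cdf (ν := μ.map norm)).tendsto (innerRadius μ)
  rw [cdf_innerRadius] at h
  exact h.mono_left nhdsWithin_le_nhds

lemma tendsto_antiRearr_of_not_isBounded (hb : ¬ Bornology.IsBounded μ.support) :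
    Tendsto (antiRearr (μ.map norm)) (𝓝[>] (innerRadius μ)) atTop ∧
      Tendsto (antiRearr (μ.map norm)) atTop (𝓝 (innerRadius μ)) := by
  refine ⟨tendsto_antiRearr_atTop eventually_mem_massInterval_nhdsGT tendsto_cdf_nhdsGT_innerRadius
    (cdf_lt_one_of_not_isBounded hb), tendsto_antiRearr_inf ?_ (tendsto_cdf_atTop _)
    cdf_innerRadius fun c => cdf_pos_of_innerRadius_lt⟩
  filter_upwards [eventually_gt_atTop (innerRadius μ)] with r hr
  exact ⟨cdf_pos_of_innerRadius_lt hr, cdf_lt_one_of_not_isBounded hb r⟩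

lemma tendsto_antiRearr_of_isBounded (hb : Bornology.IsBounded μ.support) :
    Tendsto (antiRearr (μ.map norm)) (𝓝[>] (innerRadius μ)) (𝓝 (outerRadius μ)) ∧
      Tendsto (antiRearr (μ.map norm)) (𝓝[<] (outerRadius μ)) (𝓝 (innerRadius μ)) := by
  refine ⟨tendsto_antiRearr_sup eventually_mem_massInterval_nhdsGT tendsto_cdf_nhdsGT_innerRadius
    (cdf_outerRadius hb) fun c => cdf_lt_one_of_lt_outerRadius, tendsto_antiRearr_inf ?_ ?_
    cdf_innerRadius fun c => cdf_pos_of_innerRadius_lt⟩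
  · obtain ⟨i, hi⟩ := massInterval_nonempty (μ := μ)
    have h : i < outerRadius μ := by
      by_contra! h
      linarith [monotone_cdf (μ.map norm) h, hi.2, cdf_outerRadius hb]
    filter_upwards [Ioo_mem_nhdsLT h] with r hr
    exact ⟨hi.1.trans_le (monotone_cdf _ hr.1.le), cdf_lt_one_of_lt_outerRadius hr.2⟩
  · have h := (continuous_cdf (ν := μ.map norm)).tendsto (outerRadius μ)
    rw [cdf_outerRadius hb] at h
    exact h.mono_left nhdsWithin_le_nhds

lemma radialInterval_eq_Ioi (h0 : (0 : E d) ∈ μ.support) (hb : ¬ Bornology.IsBounded μ.support) :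
    radialInterval μ = Ioi 0 := by
  ext r
  refine ⟨fun ⟨⟨x, _, hx⟩, _⟩ => (norm_nonneg x).trans_lt hx, fun hr => ⟨⟨0, h0, by simpa using hr⟩,
    cdf_map_norm_lt_one_iff.1 (cdf_lt_one_of_not_isBounded hb r)⟩⟩

end RadialLaw

/-! ### Comparing the cost with `ℓ(|x| + |y|)` -/

section Cost

variable {d : ℕ} {ℓ : ℝ≥0∞ → ℝ≥0∞}

lemma AdmissibleCost.le_cost (hℓ : AdmissibleCost d ℓ) {x y : E d} (hx : x ≠ 0) :
    ℓ (ENNReal.ofReal (‖x‖ + ‖y‖)) ≤ cost ℓ x y := by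
  by_cases hxy : x = y
  · rw [← hxy, hℓ.cost_diag]
    exact le_top
  have h1 : 0 < ‖x - y‖ := norm_pos_iff.2 (sub_ne_zero.2 hxy)
  have h2 : 0 < ‖x‖ + ‖y‖ := add_pos_of_pos_of_nonneg (norm_pos_iff.2 hx) (norm_nonneg y)
  rw [cost, edist_dist, dist_eq_norm, ← hℓ.ofReal_realProfile h1, ← hℓ.ofReal_realProfile h2]
  exact ENNReal.ofReal_le_ofReal (hℓ.strictAnti.antitoneOn h1 h2 (norm_sub_le x y))

/-- Strict monotonicity excludes a strict triangle inequality, and the infinite diagonal cost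
excludes `x = y`. -/
lemma AdmissibleCost.norm_sub_eq_of_cost_eq (hℓ : AdmissibleCost d ℓ) {x y : E d} (hx : x ≠ 0)
    (h : ℓ (ENNReal.ofReal (‖x‖ + ‖y‖)) = cost ℓ x y) : ‖x - y‖ = ‖x‖ + ‖y‖ := by
  have h2 : 0 < ‖x‖ + ‖y‖ := add_pos_of_pos_of_nonneg (norm_pos_iff.2 hx) (norm_nonneg y)
  by_cases hxy : x = y
  · subst hxy
    rw [hℓ.cost_diag] at h
    exact absurd h (hℓ.finite _ h2)
  have h1 : 0 < ‖x - y‖ := norm_pos_iff.2 (sub_ne_zero.2 hxy)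
  refine le_antisymm (norm_sub_le x y) (not_lt.1 fun hlt => ?_)
  have h3 := hℓ.strictAnti h1 h2 hlt
  rw [cost, edist_dist, dist_eq_norm] at h
  rw [realProfile, realProfile, h] at h3
  exact lt_irrefl _ h3

lemma AdmissibleCost.measurable_cost (hℓ : AdmissibleCost d ℓ) :
    Measurable fun p : E d × E d => cost ℓ p.1 p.2 := hℓ.cost_lsc.measurable

end Cost

/-! ### Direction-reversing radial maps -/

section RadialMap

variable {d : ℕ}

lemma measurable_radialMap {g : ℝ → ℝ} (hg : Measurable g) :
    Measurable (radialMap g : E d → E d) := by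
  unfold radialMap
  fun_prop

lemma norm_radialMap_neg {G : ℝ → ℝ} {x : E d} (hx : x ≠ 0) (hG : 0 ≤ G ‖x‖) :
    ‖radialMap (fun r => -G r) x‖ = G ‖x‖ := by
  have h : ‖x‖ ≠ 0 := norm_ne_zero_iff.2 hx
  rw [radialMap, norm_smul, norm_smul, norm_inv, norm_norm, inv_mul_cancel₀ h, mul_one, norm_neg,
    Real.norm_of_nonneg hG]

/-- Equality in the triangle inequality for `x` and `-y` puts them on one ray, by strict convexity
of the Euclidean norm. -/
lemma eq_radialMap_neg_of_norm {G : ℝ → ℝ} {x y : E d} (hx : x ≠ 0)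
    (hadd : ‖x - y‖ = ‖x‖ + ‖y‖) (hy : ‖y‖ = G ‖x‖) : y = radialMap (fun r => -G r) x := by
  have h : ‖x‖ ≠ 0 := norm_ne_zero_iff.2 hx
  have hray : SameRay ℝ x (-y) := by
    rw [sameRay_iff_norm_add, norm_neg, ← sub_eq_add_neg, hadd]
  have h1 := hray.norm_smul_eq
  rw [norm_neg, smul_neg, neg_eq_iff_eq_neg] at h1
  rw [radialMap, ← hy, smul_comm, neg_smul, ← h1, inv_smul_smul₀ h]

lemma norm_sub_radialMap_neg {G : ℝ → ℝ} {x : E d} (hx : x ≠ 0) (hG : 0 ≤ G ‖x‖) :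
    ‖x - radialMap (fun r => -G r) x‖ = ‖x‖ + G ‖x‖ := by
  have h : 0 < ‖x‖ := norm_pos_iff.2 hx
  have : x - radialMap (fun r => -G r) x = (1 + G ‖x‖ * ‖x‖⁻¹) • x := by
    rw [radialMap, add_smul, one_smul, neg_smul, sub_neg_eq_add, smul_smul]
  rw [this, norm_smul, Real.norm_of_nonneg (by positivity)]
  field_simp

end RadialMap

/-! ### Plans, marginals and graphs -/

section Plans

variable {d : ℕ} {μ : Measure (E d)}

lemma IsPlan.isProbabilityMeasure [IsProbabilityMeasure μ] {ν : Measure (E d)}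
    {γ : Measure (E d × E d)} (h : IsPlan μ ν γ) : IsProbabilityMeasure γ := by
  refine ⟨?_⟩
  rw [← measure_univ (μ := μ), ← h.1, Measure.map_apply measurable_fst .univ, preimage_univ]

lemma isPlan_planOfMap {ν : Measure (E d)} {T : E d → E d} (h : IsTransportMap μ ν T) :
    IsPlan μ ν (planOfMap μ T) := by
  have hT := h.1
  have hm : Measurable fun x => (x, T x) := by fun_prop
  refine ⟨?_, ?_⟩
  · rw [planOfMap, Measure.map_map measurable_fst hm]
    exact Measure.map_id
  · rw [planOfMap, Measure.map_map measurable_snd hm]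
    exact h.2

lemma AdmissibleCost.planCost_planOfMap {ℓ : ℝ≥0∞ → ℝ≥0∞} (hℓ : AdmissibleCost d ℓ)
    {T : E d → E d} (hT : Measurable T) : planCost ℓ (planOfMap μ T) = mapCost ℓ μ T := by
  rw [planCost, planOfMap, lintegral_map hℓ.measurable_cost (by fun_prop)]
  rfl

/-- A plan carried by the graph of `T` is the plan of `T`. -/
lemma IsPlan.eq_planOfMap {ν : Measure (E d)} {γ : Measure (E d × E d)} (h : IsPlan μ ν γ)
    {T : E d → E d} (hT : Measurable T) (hγ : ∀ᵐ p ∂γ, p.2 = T p.1) : γ = planOfMap μ T := by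
  rw [planOfMap, ← h.1, Measure.map_map (by fun_prop) measurable_fst]
  conv_lhs => rw [← Measure.map_id (μ := γ)]
  refine Measure.map_congr ?_
  filter_upwards [hγ] with p hp
  exact Prod.ext rfl hp

lemma ae_planOfMap {T : E d → E d} (hT : Measurable T) :
    ∀ᵐ p ∂(planOfMap μ T), p.2 = T p.1 :=
  (ae_map_iff (by fun_prop) (measurableSet_eq_fun measurable_snd (hT.comp measurable_fst))).2
    (ae_of_all _ fun _ => rfl)

lemma ae_eq_of_planOfMap_eq {S T : E d → E d} (hS : Measurable S) (hT : Measurable T)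
    (h : planOfMap μ S = planOfMap μ T) : ∀ᵐ x ∂μ, S x = T x := by
  have h1 := ae_planOfMap (μ := μ) hT
  rw [← h, planOfMap] at h1
  exact ae_of_ae_map (by fun_prop) h1

lemma IsPlan.ae_fst {ν : Measure (E d)} {γ : Measure (E d × E d)} (h : IsPlan μ ν γ)
    {P : E d → Prop} (hP : ∀ᵐ x ∂μ, P x) : ∀ᵐ p ∂γ, P p.1 :=
  ae_of_ae_map measurable_fst.aemeasurable (h.1.symm ▸ hP)

lemma IsPlan.ae_snd {ν : Measure (E d)} {γ : Measure (E d × E d)} (h : IsPlan ν μ γ)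
    {P : E d → Prop} (hP : ∀ᵐ x ∂μ, P x) : ∀ᵐ p ∂γ, P p.2 :=
  ae_of_ae_map measurable_snd.aemeasurable (h.2.symm ▸ hP)

lemma measurable_decay_norm {ℓ : ℝ≥0∞ → ℝ≥0∞} (a : ℝ) :
    Measurable fun y : E d => decay ℓ (a + ‖y‖) :=
  measurable_decay.comp (measurable_norm.const_add a)

lemma IsPlan.setLIntegral_snd {ℓ : ℝ≥0∞ → ℝ≥0∞} {ν : Measure (E d)} {γ : Measure (E d × E d)}
    (h : IsPlan ν μ γ) (a b : ℝ) : ∫⁻ p in {p | b < ‖p.2‖}, decay ℓ (a + ‖p.2‖) ∂γ =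
      ∫⁻ y in {y | b < ‖y‖}, decay ℓ (a + ‖y‖) ∂μ := by
  rw [← h.2, setLIntegral_map (measurableSet_lt measurable_const measurable_norm)
    (measurable_decay_norm a) measurable_snd]
  rfl

end Plans

/-! ### Optimality at each radius -/

section Optimality

variable {d : ℕ} {ℓ : ℝ≥0∞ → ℝ≥0∞} {μ : Measure (E d)} [IsProbabilityMeasure μ]

/-- The radial map that reverses the direction and rearranges the radius antitonically. -/
def antiMap (μ : Measure (E d)) : E d → E d := radialMap fun r => -antiRearr (μ.map norm) r

variable [NullSingletonClass (μ.map norm)]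

lemma measurable_antiMap : Measurable (antiMap μ) :=
  measurable_radialMap measurable_antiRearr.neg

lemma antiRearr_map_norm_nonneg (r : ℝ) : 0 ≤ antiRearr (μ.map norm) r :=
  antiRearr_nonneg cdf_map_norm_of_nonpos r

lemma norm_antiMap {x : E d} (hx : x ≠ 0) : ‖antiMap μ x‖ = antiRearr (μ.map norm) ‖x‖ :=
  norm_radialMap_neg hx (antiRearr_map_norm_nonneg _)

lemma isTransportMap_antiMap [Nontrivial (E d)] {ρ : E d → ℝ≥0} (hρ : Measurable ρ)
    (hμ : μ = volume.withDensity (fun x => (ρ x : ℝ≥0∞))) (lam : ℝ → ℝ≥0)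
    (hrad : ∀ x, ρ x = lam ‖x‖) : IsTransportMap μ μ (antiMap μ) := by
  refine ⟨measurable_antiMap, ?_⟩
  have hpos : ∀ᵐ x ∂μ, 0 < antiRearr (μ.map norm) ‖x‖ := by
    filter_upwards [ae_norm_mem_massInterval (μ := μ)] with x hx
    exact antiRearr_pos cdf_map_norm_of_nonpos hx
  have h1 := map_radial_eq volume hρ lam hrad hμ measurable_antiRearr hpos map_antiRearr
  have h2 : antiMap μ = Neg.neg ∘ fun x => antiRearr (μ.map norm) ‖x‖ • (‖x‖⁻¹ • x) := by
    ext x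
    simp [antiMap, radialMap]
  have hm : Measurable fun x : E d => antiRearr (μ.map norm) ‖x‖ • (‖x‖⁻¹ • x) :=
    measurable_radialMap measurable_antiRearr
  rw [h2, ← Measure.map_map measurable_neg hm, h1]
  exact map_neg_withDensity_radial volume lam hrad hμ

lemma IsPlan.measure_fst_lt {ν : Measure (E d)} {γ : Measure (E d × E d)} (h : IsPlan μ ν γ)
    (a : ℝ) : γ {p | ‖p.1‖ < a} = ENNReal.ofReal (cdf (μ.map norm) a) := by
  rw [ofReal_cdf_map_norm]
  conv_rhs => rw [← h.1]
  rw [Measure.map_apply measurable_fst (measurableSet_lt measurable_norm measurable_const)]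
  rfl

lemma IsPlan.measure_lt_snd {ν : Measure (E d)} {γ : Measure (E d × E d)} (h : IsPlan ν μ γ)
    (a : ℝ) : γ {p | a < ‖p.2‖} = ENNReal.ofReal (1 - cdf (μ.map norm) a) := by
  rw [ofReal_one_sub_cdf_map_norm]
  conv_rhs => rw [← h.2]
  rw [Measure.map_apply measurable_snd (measurableSet_lt measurable_const measurable_norm)]
  rfl

lemma measurableSet_lt_norm_snd (b : ℝ) : MeasurableSet {p : E d × E d | b < ‖p.2‖} :=
  measurableSet_lt measurable_const (by fun_prop)

lemma ae_planOfMap_antiMap {a : ℝ} (ha : a ∈ massInterval (μ.map norm)) :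
    ∀ᵐ p ∂(planOfMap μ (antiMap μ)),
      p ∈ {p : E d × E d | ‖p.1‖ < a} ↔ p ∈ {p | antiRearr (μ.map norm) a < ‖p.2‖} := by
  have hm : Measurable fun x => (x, antiMap μ x) := measurable_id.prodMk measurable_antiMap
  have hset : MeasurableSet {p : E d × E d | p ∈ {p : E d × E d | ‖p.1‖ < a} ↔
      p ∈ {p | antiRearr (μ.map norm) a < ‖p.2‖}} :=
    (measurableSet_shell a).iff (measurableSet_lt_norm_snd _)
  rw [planOfMap, ae_map_iff hm.aemeasurable hset]
  filter_upwards [ae_ne_zero_of_map_norm (μ := μ),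
    ae_of_ae_map measurable_norm.aemeasurable (ae_lt_iff_antiRearr_lt ha)] with x hx h
  simpa [norm_antiMap hx] using h

/-- These are the bathtub hypotheses for `φ(p) = -ℓ'(a + |p.2|)`, with threshold its value at the
rearranged radius. -/
lemma AdmissibleCost.decay_bathtub (hℓ : AdmissibleCost d ℓ) {a : ℝ}
    (ha : a ∈ massInterval (μ.map norm)) (p : E d × E d) :
    (p ∈ {p : E d × E d | antiRearr (μ.map norm) a < ‖p.2‖} →
        decay ℓ (a + ‖p.2‖) < decay ℓ (a + antiRearr (μ.map norm) a)) ∧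
      (p ∉ {p : E d × E d | antiRearr (μ.map norm) a < ‖p.2‖} →
        decay ℓ (a + antiRearr (μ.map norm) a) ≤ decay ℓ (a + ‖p.2‖)) := by
  have ha0 : 0 < a := by
    by_contra! h
    exact ha.1.ne' (cdf_map_norm_of_nonpos a h)
  have h1 : a + antiRearr (μ.map norm) a ∈ Ioi (0 : ℝ) :=
    add_pos_of_pos_of_nonneg ha0 (antiRearr_map_norm_nonneg a)
  have h2 : a + ‖p.2‖ ∈ Ioi (0 : ℝ) := add_pos_of_pos_of_nonneg ha0 (norm_nonneg _)
  refine ⟨fun h => hℓ.strictAntiOn_decay h1 h2 (by simpa using h), fun h => ?_⟩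
  exact hℓ.strictAntiOn_decay.antitoneOn h2 h1 (by simpa using h)

lemma IsPlan.measure_shell_eq {γ : Measure (E d × E d)} (h : IsPlan μ μ γ) {a : ℝ}
    (ha : a ∈ massInterval (μ.map norm)) :
    γ {p | ‖p.1‖ < a} = γ {p | antiRearr (μ.map norm) a < ‖p.2‖} := by
  rw [h.measure_fst_lt, h.measure_lt_snd, cdf_antiRearr ha, sub_sub_cancel]

/-- The right side sees only the second marginal, so it can be moved from `γ` to the plan of the
antitone map, where both events agree almost everywhere. -/
lemma shellCost_antiMap (hT : IsTransportMap μ μ (antiMap μ)) {γ : Measure (E d × E d)}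
    (h : IsPlan μ μ γ) {a : ℝ} (ha : a ∈ massInterval (μ.map norm)) :
    shellCost ℓ (planOfMap μ (antiMap μ)) a =
      ∫⁻ p in {p | antiRearr (μ.map norm) a < ‖p.2‖}, decay ℓ (a + ‖p.2‖) ∂γ := by
  rw [h.setLIntegral_snd, ← (isPlan_planOfMap hT).setLIntegral_snd, shellCost]
  refine setLIntegral_congr ?_
  filter_upwards [ae_planOfMap_antiMap ha] with p hp
  exact propext hp

lemma AdmissibleCost.shellCost_antiMap_le (hℓ : AdmissibleCost d ℓ)
    (hT : IsTransportMap μ μ (antiMap μ)) {γ : Measure (E d × E d)} (h : IsPlan μ μ γ) (a : ℝ) :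
    shellCost ℓ (planOfMap μ (antiMap μ)) a ≤ shellCost ℓ γ a := by
  have hprob := h.isProbabilityMeasure
  have hplan := isPlan_planOfMap hT
  have hprob' := hplan.isProbabilityMeasure
  by_cases ha : a ∈ massInterval (μ.map norm)
  · rw [shellCost_antiMap hT h ha]
    exact setLIntegral_sublevel_le (measurableSet_shell a) (measurableSet_lt_norm_snd _)
      (h.measure_shell_eq ha) (fun p hp => ((hℓ.decay_bathtub ha p).1 hp).le)
      fun p hp => (hℓ.decay_bathtub ha p).2 hp
  -- Outside the mass interval the event `|x| < a` is null or almost sure, so all plans pay the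
  -- same.
  have h01 : cdf (μ.map norm) a = 0 ∨ cdf (μ.map norm) a = 1 := by
    by_contra! hc
    exact ha ⟨(cdf_nonneg _ a).lt_of_ne' hc.1, (cdf_le_one _ a).lt_of_ne hc.2⟩
  rcases h01 with h0 | h1
  · have := hplan.measure_fst_lt a
    rw [h0, ENNReal.ofReal_zero] at this
    rw [shellCost, setLIntegral_measure_zero _ _ this]
    exact zero_le
  · have key : ∀ γ' : Measure (E d × E d), IsPlan μ μ γ' →
        shellCost ℓ γ' a = ∫⁻ y, decay ℓ (a + ‖y‖) ∂μ := by
      intro γ' h'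
      have hp := h'.isProbabilityMeasure
      have hae : ∀ᵐ p ∂γ', p ∈ {p : E d × E d | ‖p.1‖ < a} := by
        refine (mem_ae_iff_prob_eq_one (measurableSet_shell a)).2 ?_
        rw [h'.measure_fst_lt, h1, ENNReal.ofReal_one]
      rw [shellCost, Measure.restrict_eq_self_of_ae_mem hae]
      conv_rhs => rw [← h'.2]
      rw [lintegral_map (measurable_decay_norm a) measurable_snd]
    rw [key _ hplan, key _ h]

lemma AdmissibleCost.ae_lt_iff_of_shellCost_le (hℓ : AdmissibleCost d ℓ)
    (hT : IsTransportMap μ μ (antiMap μ)) {γ : Measure (E d × E d)} (h : IsPlan μ μ γ) {a : ℝ}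
    (ha : a ∈ massInterval (μ.map norm))
    (hle : shellCost ℓ γ a ≤ shellCost ℓ (planOfMap μ (antiMap μ)) a) :
    ∀ᵐ p ∂γ, ‖p.1‖ < a ↔ antiRearr (μ.map norm) a < ‖p.2‖ := by
  have hprob := h.isProbabilityMeasure
  rw [shellCost_antiMap hT h ha] at hle
  exact ae_mem_iff_of_setLIntegral_le (measurableSet_shell a) (measurableSet_lt_norm_snd _)
    (h.measure_shell_eq ha) (decay_ne_top _) (fun p hp => (hℓ.decay_bathtub ha p).1 hp)
    (fun p hp => (hℓ.decay_bathtub ha p).2 hp) hle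

end Optimality

/-! ### Finite optimal cost and uniqueness of the plan -/

section Uniqueness

variable {d : ℕ} {ℓ : ℝ≥0∞ → ℝ≥0∞} {μ : Measure (E d)}
  [NullSingletonClass (μ.map norm)]

lemma AdmissibleCost.lintegral_le_planCost (hℓ : AdmissibleCost d ℓ) {γ : Measure (E d × E d)}
    (h : IsPlan μ μ γ) : ∫⁻ p, ℓ (ENNReal.ofReal (‖p.1‖ + ‖p.2‖)) ∂γ ≤ planCost ℓ γ := by
  refine lintegral_mono_ae ?_
  filter_upwards [h.ae_fst ae_ne_zero_of_map_norm] with p hp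
  exact hℓ.le_cost hp

variable [IsProbabilityMeasure μ]

lemma cost_antiMap {x : E d} (hx : x ≠ 0) :
    cost ℓ x (antiMap μ x) = ℓ (ENNReal.ofReal (‖x‖ + ‖antiMap μ x‖)) := by
  rw [cost, edist_dist, dist_eq_norm, norm_antiMap hx, antiMap,
    norm_sub_radialMap_neg hx (antiRearr_map_norm_nonneg _)]

/-- The antitone radial map moves almost every point by at least a fixed distance. -/
lemma exists_le_norm_add_antiRearr :
    ∃ b > 0, ∀ r ∈ massInterval (μ.map norm), b ≤ r + antiRearr (μ.map norm) r := by
  have h := (continuous_cdf (ν := μ.map norm)).tendsto 0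
  rw [cdf_map_norm_of_nonpos 0 le_rfl] at h
  -- If `r` and its image were both at most `b`, then `1 ≤ 2 F(b)`, which `F(b) < 1/2` excludes.
  have h2 : ∀ᶠ b in 𝓝[>] (0 : ℝ), cdf (μ.map norm) b < 1 / 2 :=
    (h.mono_left nhdsWithin_le_nhds).eventually_lt_const (by norm_num)
  obtain ⟨b, hb, hb0⟩ := (h2.and self_mem_nhdsWithin).exists
  refine ⟨b, hb0, fun r hr => ?_⟩
  have hr0 : 0 ≤ r := by
    by_contra! h
    exact hr.1.ne' (cdf_map_norm_of_nonpos r h.le)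
  rcases le_total b r with hbr | hbr
  · linarith [antiRearr_map_norm_nonneg (μ := μ) r]
  · by_contra! hlt
    have h3 : antiRearr (μ.map norm) r ≤ b := by linarith
    linarith [(antiRearr_le_iff hr).1 h3, monotone_cdf (μ.map norm) hbr]

lemma AdmissibleCost.mapCost_antiMap_ne_top (hℓ : AdmissibleCost d ℓ) :
    mapCost ℓ μ (antiMap μ) ≠ ∞ := by
  obtain ⟨b, hb, h⟩ := exists_le_norm_add_antiRearr (μ := μ)
  have hle : mapCost ℓ μ (antiMap μ) ≤ ∫⁻ _, ℓ (ENNReal.ofReal b) ∂μ := by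
    refine lintegral_mono_ae ?_
    filter_upwards [ae_ne_zero_of_map_norm (μ := μ), ae_norm_mem_massInterval (μ := μ)] with x hx hI
    have hbx := h _ hI
    have hpos : 0 < ‖x‖ + antiRearr (μ.map norm) ‖x‖ := hb.trans_le hbx
    rw [cost_antiMap hx, norm_antiMap hx, ← hℓ.ofReal_realProfile hb,
      ← hℓ.ofReal_realProfile hpos]
    exact ENNReal.ofReal_le_ofReal (hℓ.strictAnti.antitoneOn hb hpos hbx)
  rw [lintegral_const, measure_univ, mul_one] at hle
  exact (hle.trans_lt (hℓ.finite b hb).lt_top).ne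

/-- The lower bound `ℓ(|x| + |y|) ≤ c(x, y)` is sharp for the antitone radial map. -/
lemma planCost_antiMap_eq (hT : IsTransportMap μ μ (antiMap μ)) :
    planCost ℓ (planOfMap μ (antiMap μ)) =
      ∫⁻ p, ℓ (ENNReal.ofReal (‖p.1‖ + ‖p.2‖)) ∂(planOfMap μ (antiMap μ)) := by
  refine lintegral_congr_ae ?_
  filter_upwards [ae_planOfMap (μ := μ) measurable_antiMap,
    (isPlan_planOfMap hT).ae_fst ae_ne_zero_of_map_norm] with p hp hp0
  rw [hp, cost_antiMap hp0]

lemma AdmissibleCost.lintegral_antiMap_le (hℓ : AdmissibleCost d ℓ)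
    (hT : IsTransportMap μ μ (antiMap μ)) {γ : Measure (E d × E d)} (h : IsPlan μ μ γ) :
    ∫⁻ p, ℓ (ENNReal.ofReal (‖p.1‖ + ‖p.2‖)) ∂(planOfMap μ (antiMap μ)) ≤
      ∫⁻ p, ℓ (ENNReal.ofReal (‖p.1‖ + ‖p.2‖)) ∂γ := by
  obtain ⟨L, -, hL⟩ := hℓ.exists_lintegral_eq (V := E d)
  have hplan := isPlan_planOfMap hT
  have := h.isProbabilityMeasure
  have := hplan.isProbabilityMeasure
  rw [hL _ (h.ae_fst ae_ne_zero_of_map_norm), hL _ (hplan.ae_fst ae_ne_zero_of_map_norm)]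
  gcongr with a
  exact hℓ.shellCost_antiMap_le hT h a

lemma AdmissibleCost.planCost_antiMap_le (hℓ : AdmissibleCost d ℓ)
    (hT : IsTransportMap μ μ (antiMap μ)) {γ : Measure (E d × E d)} (h : IsPlan μ μ γ) :
    planCost ℓ (planOfMap μ (antiMap μ)) ≤ planCost ℓ γ := by
  rw [planCost_antiMap_eq hT]
  exact (hℓ.lintegral_antiMap_le hT h).trans (hℓ.lintegral_le_planCost h)

/-- A plan that splits almost every radius antitonically is antitone. -/
lemma ae_cdf_snd_eq {γ : Measure (E d × E d)} (h : IsPlan μ μ γ)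
    (hae : ∀ᵐ a : ℝ, a ∈ massInterval (μ.map norm) →
      ∀ᵐ p ∂γ, ‖p.1‖ < a ↔ antiRearr (μ.map norm) a < ‖p.2‖) :
    ∀ᵐ p ∂γ, cdf (μ.map norm) ‖p.2‖ = 1 - cdf (μ.map norm) ‖p.1‖ := by
  -- A full-measure set of radii is dense; a countable dense subset allows one `γ`-null set to serve
  -- all its radii.
  obtain ⟨D, hDs, hDc, hD⟩ := (Measure.dense_of_ae hae).exists_countable_dense_subset
  have hall : ∀ᵐ p ∂γ, ∀ a ∈ D, a ∈ massInterval (μ.map norm) →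
      (‖p.1‖ < a ↔ antiRearr (μ.map norm) a < ‖p.2‖) := by
    rw [ae_ball_iff hDc]
    intro a ha
    by_cases haI : a ∈ massInterval (μ.map norm)
    · filter_upwards [hDs ha haI] with p hp _ using hp
    · exact ae_of_all _ fun p h => absurd h haI
  have hcont := continuous_cdf (ν := μ.map norm)
  filter_upwards [hall, h.ae_fst ae_norm_mem_massInterval] with p hp hI
  refine le_antisymm (not_lt.1 fun hlt => ?_) (not_lt.1 fun hlt => ?_)
  -- A radius `a ∈ D` just below `|x|` still has `F(a) > 1 - F(|y|)`, while the splitting at `a`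
  -- gives `F(|y|) ≤ 1 - F(a)`. The other case takes `a` just above `|x|`.
  · have hU : IsOpen {a | a < ‖p.1‖ ∧ 1 - cdf (μ.map norm) ‖p.2‖ < cdf (μ.map norm) a} :=
      (isOpen_lt continuous_id continuous_const).inter (isOpen_lt continuous_const hcont)
    have hne : {a | a < ‖p.1‖ ∧ 1 - cdf (μ.map norm) ‖p.2‖ < cdf (μ.map norm) a}.Nonempty := by
      have h1 : ∀ᶠ a in 𝓝[<] ‖p.1‖, 1 - cdf (μ.map norm) ‖p.2‖ < cdf (μ.map norm) a :=
        (hcont.tendsto ‖p.1‖).mono_left nhdsWithin_le_nhds |>.eventually_const_lt (by linarith)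
      exact ((eventually_mem_nhdsWithin (s := Iio ‖p.1‖)).and h1).exists
    obtain ⟨a, ⟨ha1, ha2⟩, haD⟩ := hD.inter_open_nonempty _ hU hne
    have haI : a ∈ massInterval (μ.map norm) :=
      ⟨by linarith [cdf_le_one (μ.map norm) ‖p.2‖], (monotone_cdf _ ha1.le).trans_lt hI.2⟩
    have h2 := not_lt.1 ((hp a haD haI).not.1 (not_lt.2 ha1.le))
    have h3 := monotone_cdf (μ.map norm) h2
    rw [cdf_antiRearr haI] at h3
    linarith
  · have hU : IsOpen {a | ‖p.1‖ < a ∧ cdf (μ.map norm) a < 1 - cdf (μ.map norm) ‖p.2‖} :=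
      (isOpen_lt continuous_const continuous_id).inter (isOpen_lt hcont continuous_const)
    have hne : {a | ‖p.1‖ < a ∧ cdf (μ.map norm) a < 1 - cdf (μ.map norm) ‖p.2‖}.Nonempty := by
      have h1 : ∀ᶠ a in 𝓝[>] ‖p.1‖, cdf (μ.map norm) a < 1 - cdf (μ.map norm) ‖p.2‖ :=
        (hcont.tendsto ‖p.1‖).mono_left nhdsWithin_le_nhds |>.eventually_lt_const (by linarith)
      exact ((eventually_mem_nhdsWithin (s := Ioi ‖p.1‖)).and h1).exists
    obtain ⟨a, ⟨ha1, ha2⟩, haD⟩ := hD.inter_open_nonempty _ hU hne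
    have haI : a ∈ massInterval (μ.map norm) :=
      ⟨hI.1.trans_le (monotone_cdf _ ha1.le), by linarith [cdf_nonneg (μ.map norm) ‖p.2‖]⟩
    have h2 := (hp a haD haI).1 ha1
    have h3 := monotone_cdf (μ.map norm) h2.le
    rw [cdf_antiRearr haI] at h3
    linarith

lemma AdmissibleCost.eq_planOfMap_of_planCost_le (hℓ : AdmissibleCost d ℓ)
    (hT : IsTransportMap μ μ (antiMap μ)) {γ : Measure (E d × E d)} (h : IsPlan μ μ γ)
    (hle : planCost ℓ γ ≤ planCost ℓ (planOfMap μ (antiMap μ))) :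
    γ = planOfMap μ (antiMap μ) := by
  have hplan := isPlan_planOfMap hT
  have hprob := h.isProbabilityMeasure
  have hprob' := hplan.isProbabilityMeasure
  have hfin : planCost ℓ (planOfMap μ (antiMap μ)) ≠ ∞ := by
    rw [hℓ.planCost_planOfMap measurable_antiMap]
    exact hℓ.mapCost_antiMap_ne_top
  have hlow := hℓ.lintegral_le_planCost h
  have hmid := hℓ.lintegral_antiMap_le hT h
  have heq := planCost_antiMap_eq (ℓ := ℓ) hT
  -- The chain `C[γ] ≥ ∫ ℓ(|x|+|y|) dγ ≥ C[T] ≥ C[γ]`, with `T` the antitone map, collapses, and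
  -- finiteness turns equal integrals into almost everywhere equality.
  have hcost : ∀ᵐ p ∂γ, ℓ (ENNReal.ofReal (‖p.1‖ + ‖p.2‖)) = cost ℓ p.1 p.2 := by
    refine ae_eq_of_ae_le_of_lintegral_le ?_ (ne_top_of_le_ne_top hfin (hlow.trans hle))
      hℓ.measurable_cost.aemeasurable (hle.trans (heq.le.trans hmid))
    filter_upwards [h.ae_fst ae_ne_zero_of_map_norm] with p hp
    exact hℓ.le_cost hp
  have hshell : ∀ᵐ a ∂(volume.restrict (Ioi (0 : ℝ))),
      shellCost ℓ (planOfMap μ (antiMap μ)) a = shellCost ℓ γ a := by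
    obtain ⟨L, hLtop, hL⟩ := hℓ.exists_lintegral_eq (V := E d)
    have h1 := hL _ (h.ae_fst ae_ne_zero_of_map_norm)
    have h2 := hL _ (hplan.ae_fst ae_ne_zero_of_map_norm)
    have h3 := hlow.trans (hle.trans heq.le)
    rw [h1, h2, ENNReal.add_le_add_iff_left hLtop] at h3
    refine ae_eq_of_ae_le_of_lintegral_le (ae_of_all _ fun a => hℓ.shellCost_antiMap_le hT h a) ?_
      (measurable_shellCost γ).aemeasurable h3
    refine ne_top_of_le_ne_top hfin ?_
    rw [heq, h2]
    exact le_add_self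
  have hae : ∀ᵐ a : ℝ, a ∈ massInterval (μ.map norm) →
      ∀ᵐ p ∂γ, ‖p.1‖ < a ↔ antiRearr (μ.map norm) a < ‖p.2‖ := by
    filter_upwards [(ae_restrict_iff' measurableSet_Ioi).1 hshell] with a ha haI
    refine hℓ.ae_lt_iff_of_shellCost_le hT h haI (ha ?_).ge
    by_contra hneg
    exact haI.1.ne' (cdf_map_norm_of_nonpos a (not_lt.1 hneg))
  -- `|y|` and the norm of the image of `x` have equal `F`-values; both have the radial law, so both
  -- avoid the flat parts of `F` almost surely and coincide.
  obtain ⟨S, hS, hinj⟩ := exists_ae_injOn_cdf (ν := μ.map norm)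
  have hS' : ∀ᵐ x ∂μ, ‖x‖ ∈ S := ae_of_ae_map measurable_norm.aemeasurable hS
  have hST : ∀ᵐ x ∂μ, ‖antiMap μ x‖ ∈ S :=
    ae_of_ae_map measurable_antiMap.aemeasurable (hT.2.symm ▸ hS')
  refine h.eq_planOfMap measurable_antiMap ?_
  filter_upwards [ae_cdf_snd_eq h hae, hcost, h.ae_fst ae_ne_zero_of_map_norm,
    h.ae_fst ae_norm_mem_massInterval, h.ae_fst hST, h.ae_snd hS'] with p hF hc h0 hI hS1 hS2
  refine eq_radialMap_neg_of_norm h0 (hℓ.norm_sub_eq_of_cost_eq h0 hc) ?_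
  rw [norm_antiMap h0] at hS1
  exact hinj hS2 hS1 (by rw [hF, cdf_antiRearr hI])

end Uniqueness

end RadialTransport

end

open RadialTransport in
theorem theorem4p2 (d : ℕ) (hd : 1 ≤ d)
    (ℓ : ℝ≥0∞ → ℝ≥0∞) (hℓ : AdmissibleCost d ℓ)
    (μ : Measure (E d)) [IsProbabilityMeasure μ]
    (ρ : E d → ℝ≥0) (hρ : Measurable ρ)
    (hμ : μ = volume.withDensity (fun x => (ρ x : ℝ≥0∞)))
    (lam : ℝ → ℝ≥0) (hrad : ∀ x, ρ x = lam ‖x‖)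
    (hpos : ∀ x ∈ μ.support, 0 < ρ x) :
    ∃ g : ℝ → ℝ,
      -- the optimal plan and the optimal map exist, are unique, and are given by `g`
      (∀ γ : Measure (E d × E d),
        IsOptimalPlan ℓ μ μ γ ↔ γ = planOfMap μ (radialMap g)) ∧
      IsOptimalMap ℓ μ μ (radialMap g) ∧
      (∀ T : E d → E d, IsOptimalMap ℓ μ μ T → ∀ᵐ x ∂μ, T x = radialMap g x) ∧
      -- `g ≤ 0`, and `g` is increasing, strictly so across any shell of positive mass
      (∀ r, 0 ≤ r → g r ≤ 0) ∧
      MonotoneOn g (radialInterval μ) ∧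
      (∀ s ∈ radialInterval μ, ∀ t ∈ radialInterval μ, s < t →
        0 < μ {x | s < ‖x‖ ∧ ‖x‖ < t} → g s < g t) ∧
      -- the limits of `g` at the ends of its interval
      ((0 : E d) ∈ μ.support → ¬ Bornology.IsBounded μ.support →
        radialInterval μ = Ioi 0 ∧ Tendsto g (𝓝[>] 0) atBot ∧ Tendsto g atTop (𝓝 0)) ∧
      (¬ Bornology.IsBounded μ.support →
        Tendsto g (𝓝[>] (innerRadius μ)) atBot ∧ Tendsto g atTop (𝓝 (-innerRadius μ))) ∧
      (Bornology.IsBounded μ.support →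
        Tendsto g (𝓝[>] (innerRadius μ)) (𝓝 (-outerRadius μ)) ∧
        Tendsto g (𝓝[<] (outerRadius μ)) (𝓝 (-innerRadius μ))) := by
  have : Nonempty (Fin d) := ⟨⟨0, hd⟩⟩
  have hac : μ ≪ volume := hμ ▸ withDensity_absolutelyContinuous _ _
  have : NullSingletonClass (μ.map norm) := nullSingletonClass_map_norm hac
  have hT : IsTransportMap μ μ (antiMap μ) := isTransportMap_antiMap hρ hμ lam hrad
  have hplan := isPlan_planOfMap hT
  have hopt : IsOptimalPlan ℓ μ μ (planOfMap μ (antiMap μ)) :=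
    ⟨hplan, fun γ' h' => hℓ.planCost_antiMap_le hT h'⟩
  have huniq : ∀ γ, IsOptimalPlan ℓ μ μ γ → γ = planOfMap μ (antiMap μ) := fun γ h =>
    hℓ.eq_planOfMap_of_planCost_le hT h.1 (h.2 _ hplan)
  -- Every transport map is a plan of the same cost, so optimality among plans passes to maps.
  have hmap : ∀ S, IsTransportMap μ μ S → mapCost ℓ μ (antiMap μ) ≤ mapCost ℓ μ S := by
    intro S hS
    rw [← hℓ.planCost_planOfMap hT.1, ← hℓ.planCost_planOfMap hS.1]
    exact hopt.2 _ (isPlan_planOfMap hS)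
  refine ⟨fun r => -antiRearr (μ.map norm) r, fun γ => ⟨huniq γ, fun h => h ▸ hopt⟩, ⟨hT, hmap⟩,
    fun S hS => ?_, fun r _ => neg_nonpos.2 (antiRearr_map_norm_nonneg r), ?_, ?_, ?_, ?_, ?_⟩
  · refine ae_eq_of_planOfMap_eq hS.1.1 hT.1
      (hℓ.eq_planOfMap_of_planCost_le hT (isPlan_planOfMap hS.1) ?_)
    rw [hℓ.planCost_planOfMap hT.1, hℓ.planCost_planOfMap hS.1.1]
    exact hS.2 _ hT
  · rw [radialInterval_eq_massInterval]
    exact antitoneOn_antiRearr.neg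
  · rw [radialInterval_eq_massInterval]
    exact fun s hs t ht _ hpos =>
      neg_lt_neg (antiRearr_lt_of_cdf_lt hs ht (cdf_map_norm_lt_cdf hpos))
  · intro h0 hb
    have h := tendsto_antiRearr_of_not_isBounded hb
    rw [innerRadius_eq_zero h0] at h
    exact ⟨radialInterval_eq_Ioi h0 hb, tendsto_neg_atTop_atBot.comp h.1, by simpa using h.2.neg⟩
  · intro hb
    have h := tendsto_antiRearr_of_not_isBounded hb
    exact ⟨tendsto_neg_atTop_atBot.comp h.1, h.2.neg⟩
  · intro hb
    have h := tendsto_antiRearr_of_isBounded hb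
    exact ⟨h.1.neg, h.2.neg⟩
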